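/- **Setting.** $\mathcal H_2$ denotes the Hilbert space of transfer matrices $G(z)=\sum_{i\ge 0} z^{-i}G_i$ ($|z|>1$) with complex $p\times q$ coefficients and $\sum_i \mathrm{Tr}(G_iG_i^*)<\infty$, with $\langle G,H\rangle=\sum_i \mathrm{Tr}(G_iH_i^*)$; $\mathbf P_{\mathcal M}$ is the orthogonal projection onto a closed subspace $\mathcal M$. For real matrices write $\left[\begin{smallmatrix}A&B\\ C&D\end{smallmatrix}\right]=C(zI-A)^{-1}B+D$. Let $$P_{11}=\begin{bmatrix}A&B_1\\ C_1&0\end{bmatrix},\quad P_{12}=\begin{bmatrix}A&B_2\\ C_1&D_{12}\end{bmatrix},\quad P_{21}=\begin{bmatrix}A&B_1\\ C_2&D_{21}\end{bmatrix}$$ (realizations) be given by real matrices, with inputs of dimensions $p_1,p_2$ and outputs of dimensions $q_1,q_2$, where all eigenvalues of $A$ lie in the open unit disc and $D_{12}^TD_{12}$ and $D_{21}D_{21}^T$ are positive definite. Let the symmetric real matrices $X$, $Y$ be the stabilizing solutions of the Riccati equations $$X=C_1^TC_1+A^TXA-(A^TXB_2+C_1^TD_{12})\Omega^{-1}(B_2^TXA+D_{12}^TC_1),\qquad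 \Omega=D_{12}^TD_{12}+B_2^TXB_2,$$ $$Y=B_1B_1^T+AYA^T-(AYC_2^T+B_1D_{21}^T)\Psi^{-1}(C_2YA^T+D_{21}B_1^T),\qquad \Psi=D_{21}D_{21}^T+C_2YC_2^T,$$ that is, with $K=-\Omega^{-1}(B_2^TXA+D_{12}^TC_1)$ and $L=-(AYC_2^T+B_1D_{21}^T)\Psi^{-1}$, all eigenvalues of $A+B_2K$ and of $A+LC_2$ lie in the open unit disc. Put (realizations) $$W_L=\begin{bmatrix}A+B_2K&B_2\\ K&I\end{bmatrix}\Omega^{-1/2},\quad W_R=\Psi^{-1/2}\begin{bmatrix}A+LC_2&L\\ C_2&I\end{bmatrix},\quad T=\Omega^{1/2}\begin{bmatrix}A&L\\ K&0\end{bmatrix}\Psi^{1/2}.$$ Let $N\ge1$, let $\mathcal X=\bigoplus_{i=1}^N z^{-i}\mathbb C^{p_2\times q_2}$, let $\mathcal Y$ be a real linear subspace of $\bigoplus_{i=1}^N z^{-i}\mathbb R^{p_2\times q_2}$, and put $$Q_N=-W_L\,\mathbf P_{z^{-(N+1)}\mathcal H_2}(T)\,W_R .$$ **Lemma.** The transfer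 matrix $Q_N$ is the unique minimizer of $\|P_{11}+P_{12}QP_{21}\|_{\mathcal H_2}$ over $Q\in z^{-(N+1)}\mathcal H_2$ (the delayed centralized problem). For every $V\in\mathcal Y$, the problem $$\min_{U\in z^{-(N+1)}\mathcal H_2}\ \|P_{11}+P_{12}VP_{21}+P_{12}UP_{21}\|_{\mathcal H_2}$$ has the unique optimal solution $$U(V)=Q_N-W_L\,\mathbf P_{z^{-(N+1)}\mathcal H_2}\!\left(W_L^{-1}VW_R^{-1}\right)W_R ,$$ and the optimal cost is $$\|P_{11}+P_{12}VP_{21}+P_{12}U(V)P_{21}\|^2=\|P_{11}+P_{12}Q_NP_{21}\|^2+\left\|\mathbf P_{\mathcal X}(W_L^{-1}VW_R^{-1})\right\|^2+2\left\langle \mathbf P_{\mathcal X}(W_L^{-1}VW_R^{-1}),T\right\rangle ,$$ all norms being those of $\mathcal H_2$; in particular the last inner product is real. All transfer matrices occurring here inside norms, inner products and projections lie in $\mathcal H_2$. -/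

import Mathlib

open scoped MatrixOrder

noncomputable section

namespace H2Model

/-! ### The Hilbert space `H2` of `p × q` transfer matrices -/

/-- The Hilbert space `H2` of `p × q` transfer matrices `G(z) = ∑ i, z^{-i} G_i`, an element being
given by its square-summable sequence of complex coefficient matrices. Each coefficient carries the
Frobenius inner product, so that the norm and the inner product of `lp` are those of `H2`
(see `inner_eq_tsum_trace` and `norm_sq_eq_tsum_trace`). -/
abbrev H2 (p q : ℕ) : Type := lp (fun _ : ℕ => EuclideanSpace ℂ (Fin p × Fin q)) 2

variable {p q : ℕ}

/-- The coefficient matrix `G_i` in `G(z) = ∑ i, z^{-i} G_i`. -/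
def coeff (G : H2 p q) (i : ℕ) : Matrix (Fin p) (Fin q) ℂ :=
  Matrix.of fun a b => G i (a, b)

/-- `F` is, on the exterior `|z| > 1` of the closed unit disc, the function
`z ↦ ∑ i, z^{-i} G_i` of the element `G` of `H2`. -/
def HasExpansion (F : ℂ → Matrix (Fin p) (Fin q) ℂ) (G : H2 p q) : Prop :=
  ∀ z : ℂ, 1 < ‖z‖ → HasSum (fun i => (z ^ i)⁻¹ • coeff G i) (F z)

/-- The transfer matrix `F`, a function of `z` on `|z| > 1`, lies in `H2`. -/
def MemH2 (F : ℂ → Matrix (Fin p) (Fin q) ℂ) : Prop := ∃ G : H2 p q, HasExpansion F G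

open Classical in
/-- The element of `H2` whose function is `F` (only meaningful when `MemH2 F`). -/
def toH2 (F : ℂ → Matrix (Fin p) (Fin q) ℂ) : H2 p q :=
  if h : MemH2 F then h.choose else 0

/-- The function `z ↦ ∑ i, z^{-i} G_i` of an element of `H2` (used for `|z| > 1`). -/
def eval (G : H2 p q) (z : ℂ) : Matrix (Fin p) (Fin q) ℂ := ∑' i, (z ^ i)⁻¹ • coeff G i

/-- `⟨G, H⟩ = ∑ i, Tr (G_i H_i^*)`; Mathlib's inner product is linear in its second argument. -/
theorem inner_eq_tsum_trace (G H : H2 p q) :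
    inner ℂ H G = ∑' i, (coeff G i * (coeff H i).conjTranspose).trace := by
  rw [lp.inner_eq_tsum]
  refine tsum_congr fun i => ?_
  simp [PiLp.inner_apply, Fintype.sum_prod_type, Matrix.trace, Matrix.mul_apply, coeff]

theorem norm_sq_eq_tsum_trace (G : H2 p q) :
    ((‖G‖ ^ 2 : ℝ) : ℂ) = ∑' i, (coeff G i * (coeff G i).conjTranspose).trace := by
  rw [← inner_eq_tsum_trace, inner_self_eq_norm_sq_to_K]
  simp

/-! ### Subspaces -/

/-- The elements of `H2` all of whose nonzero coefficients have an index in `s`. -/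
def supportedOn (p q : ℕ) (s : Set ℕ) : Submodule ℂ (H2 p q) where
  carrier := {G | ∀ i, i ∉ s → G i = 0}
  zero_mem' := fun i _ => by simp
  add_mem' := fun {F G} hF hG i hi => by simp [hF i hi, hG i hi]
  smul_mem' := fun c G hG i hi => by simp [hG i hi]

theorem isClosed_supportedOn (s : Set ℕ) :
    IsClosed (supportedOn p q s : Set (H2 p q)) := by
  have h : (supportedOn p q s : Set (H2 p q)) =
      ⋂ i, ⋂ (_ : i ∉ s),
        {G : H2 p q | lp.evalCLM ℂ (fun _ : ℕ => EuclideanSpace ℂ (Fin p × Fin q)) 2 i G = 0} := by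
    ext G
    simp [supportedOn]
    rfl
  rw [h]
  exact isClosed_iInter fun i => isClosed_iInter fun _ =>
    isClosed_eq (ContinuousLinearMap.continuous _) continuous_const

instance hasOrthogonalProjection_supportedOn (s : Set ℕ) :
    (supportedOn p q s).HasOrthogonalProjection := by
  have : CompleteSpace (supportedOn p q s) :=
    (isClosed_supportedOn s).isComplete.completeSpace_coe
  infer_instance

/-- The subspace `z^{-k} H2`. -/
abbrev delayed (p q k : ℕ) : Submodule ℂ (H2 p q) := supportedOn p q (Set.Ici k)

/-- The space `𝒳` of strictly proper FIR transfer matrices `∑_{i=1}^N z^{-i} G_i`, `G_i` complex. -/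
abbrev firSpace (p q N : ℕ) : Submodule ℂ (H2 p q) := supportedOn p q (Set.Icc 1 N)

/-- The real space of strictly proper FIR transfer matrices `∑_{i=1}^N z^{-i} V_i`, `V_i` real. -/
def realFirSpace (p q N : ℕ) : Submodule ℝ (H2 p q) where
  carrier := {V | V ∈ firSpace p q N ∧ ∀ i a b, (coeff V i a b).im = 0}
  zero_mem' := ⟨Submodule.zero_mem _, fun i a b => by simp [coeff]⟩
  add_mem' := fun {F G} hF hG => ⟨Submodule.add_mem _ hF.1 hG.1, fun i a b => by
    have h1 := hF.2 i a b
    have h2 := hG.2 i a b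
    simp only [coeff, Matrix.of_apply] at h1 h2
    simp [coeff, h1, h2]⟩
  smul_mem' := fun c G hG => ⟨fun i hi => by simp [hG.1 i hi], fun i a b => by
    have h1 := hG.2 i a b
    simp only [coeff, Matrix.of_apply] at h1
    simp [coeff, h1]⟩

/-- `x` is the unique minimizer of `f` on `s`. -/
def IsUniqueMinimizerOn {α : Type*} (f : α → ℝ) (s : Set α) (x : α) : Prop :=
  x ∈ s ∧ ∀ y ∈ s, y ≠ x → f x < f y

/-! ### State-space realizations and Riccati equations -/

/-- The complex matrix with the same (real) entries. -/
abbrev cpx {m n : ℕ} (M : Matrix (Fin m) (Fin n) ℝ) : Matrix (Fin m) (Fin n) ℂ :=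
  M.map Complex.ofReal

/-- The transfer matrix `C (zI - A)⁻¹ B + D` of a real state-space realization. -/
def realization {n m k : ℕ} (A : Matrix (Fin n) (Fin n) ℝ) (B : Matrix (Fin n) (Fin m) ℝ)
    (C : Matrix (Fin k) (Fin n) ℝ) (D : Matrix (Fin k) (Fin m) ℝ) (z : ℂ) :
    Matrix (Fin k) (Fin m) ℂ :=
  cpx C * (z • (1 : Matrix (Fin n) (Fin n) ℂ) - cpx A)⁻¹ * cpx B + cpx D

/-- Discrete-time stability: all complex eigenvalues lie in the open unit disc. -/
def IsStable {n : ℕ} (A : Matrix (Fin n) (Fin n) ℝ) : Prop :=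
  ∀ μ ∈ spectrum ℂ (cpx A), ‖μ‖ < 1

/-- State-space data of the plant
`P = [A | B₁ B₂; C₁ | 0 D₁₂; C₂ | D₂₁ 0]`, with inputs of dimensions `p₁`, `p₂` and outputs of
dimensions `q₁`, `q₂`. -/
structure Plant (n p₁ p₂ q₁ q₂ : ℕ) where
  A : Matrix (Fin n) (Fin n) ℝ
  B₁ : Matrix (Fin n) (Fin p₁) ℝ
  B₂ : Matrix (Fin n) (Fin p₂) ℝ
  C₁ : Matrix (Fin q₁) (Fin n) ℝ
  C₂ : Matrix (Fin q₂) (Fin n) ℝ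
  D₁₂ : Matrix (Fin q₁) (Fin p₂) ℝ
  D₂₁ : Matrix (Fin q₂) (Fin p₁) ℝ

namespace Plant

variable {n p₁ p₂ q₁ q₂ : ℕ} (P : Plant n p₁ p₂ q₁ q₂)

def P₁₁ : ℂ → Matrix (Fin q₁) (Fin p₁) ℂ := realization P.A P.B₁ P.C₁ 0

def P₁₂ : ℂ → Matrix (Fin q₁) (Fin p₂) ℂ := realization P.A P.B₂ P.C₁ P.D₁₂

def P₂₁ : ℂ → Matrix (Fin q₂) (Fin p₁) ℂ := realization P.A P.B₁ P.C₂ P.D₂₁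

/-- `Ω = D₁₂ᵀ D₁₂ + B₂ᵀ X B₂`. -/
def Omega (X : Matrix (Fin n) (Fin n) ℝ) : Matrix (Fin p₂) (Fin p₂) ℝ :=
  P.D₁₂.transpose * P.D₁₂ + P.B₂.transpose * X * P.B₂

/-- The linear quadratic regulator gain. -/
def gainK (X : Matrix (Fin n) (Fin n) ℝ) : Matrix (Fin p₂) (Fin n) ℝ :=
  -((P.Omega X)⁻¹ * (P.B₂.transpose * X * P.A + P.D₁₂.transpose * P.C₁))

/-- `X` is a stabilizing solution of the control Riccati equation. -/
def IsControlRiccati (X : Matrix (Fin n) (Fin n) ℝ) : Prop :=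
  X.IsSymm ∧
  X = P.C₁.transpose * P.C₁ + P.A.transpose * X * P.A
    - (P.A.transpose * X * P.B₂ + P.C₁.transpose * P.D₁₂) * (P.Omega X)⁻¹
      * (P.B₂.transpose * X * P.A + P.D₁₂.transpose * P.C₁) ∧
  IsStable (P.A + P.B₂ * P.gainK X)

/-- `Ψ = D₂₁ D₂₁ᵀ + C₂ Y C₂ᵀ`. -/
def Psi (Y : Matrix (Fin n) (Fin n) ℝ) : Matrix (Fin q₂) (Fin q₂) ℝ :=
  P.D₂₁ * P.D₂₁.transpose + P.C₂ * Y * P.C₂.transpose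

/-- The Kalman filter gain. -/
def gainL (Y : Matrix (Fin n) (Fin n) ℝ) : Matrix (Fin n) (Fin q₂) ℝ :=
  -((P.A * Y * P.C₂.transpose + P.B₁ * P.D₂₁.transpose) * (P.Psi Y)⁻¹)

/-- `Y` is a stabilizing solution of the estimation Riccati equation. -/
def IsEstimationRiccati (Y : Matrix (Fin n) (Fin n) ℝ) : Prop :=
  Y.IsSymm ∧
  Y = P.B₁ * P.B₁.transpose + P.A * Y * P.A.transpose
    - (P.A * Y * P.C₂.transpose + P.B₁ * P.D₂₁.transpose) * (P.Psi Y)⁻¹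
      * (P.C₂ * Y * P.A.transpose + P.D₂₁ * P.B₁.transpose) ∧
  IsStable (P.A + P.gainL Y * P.C₂)

/-- The left spectral factor `W_L = [A + B₂K | B₂; K | I] Ω^{-1/2}`. -/
def WL (X : Matrix (Fin n) (Fin n) ℝ) (z : ℂ) : Matrix (Fin p₂) (Fin p₂) ℂ :=
  realization (P.A + P.B₂ * P.gainK X) P.B₂ (P.gainK X) 1 z * cpx (CFC.sqrt (P.Omega X))⁻¹

/-- The right spectral factor `W_R = Ψ^{-1/2} [A + LC₂ | L; C₂ | I]`. -/
def WR (Y : Matrix (Fin n) (Fin n) ℝ) (z : ℂ) : Matrix (Fin q₂) (Fin q₂) ℂ :=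
  cpx (CFC.sqrt (P.Psi Y))⁻¹ * realization (P.A + P.gainL Y * P.C₂) (P.gainL Y) P.C₂ 1 z

/-- `T = Ω^{1/2} [A | L; K | 0] Ψ^{1/2}`. -/
def T (X Y : Matrix (Fin n) (Fin n) ℝ) (z : ℂ) : Matrix (Fin p₂) (Fin q₂) ℂ :=
  cpx (CFC.sqrt (P.Omega X)) * realization P.A (P.gainL Y) (P.gainK X) 0 z
    * cpx (CFC.sqrt (P.Psi Y))

/-- The closed loop `P₁₁ + P₁₂ Q P₂₁`. -/
def closedLoop (Q : ℂ → Matrix (Fin p₂) (Fin q₂) ℂ) (z : ℂ) : Matrix (Fin q₁) (Fin p₁) ℂ :=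
  P.P₁₁ z + P.P₁₂ z * Q z * P.P₂₁ z

/-- The function `W_L⁻¹ V W_R⁻¹`. -/
def whiten (X Y : Matrix (Fin n) (Fin n) ℝ) (V : H2 p₂ q₂) (z : ℂ) :
    Matrix (Fin p₂) (Fin q₂) ℂ :=
  (P.WL X z)⁻¹ * eval V z * (P.WR Y z)⁻¹

/-- The function `Q_N = -W_L P_{z^{-(N+1)}H2}(T) W_R`. -/
def QN (X Y : Matrix (Fin n) (Fin n) ℝ) (N : ℕ) (z : ℂ) : Matrix (Fin p₂) (Fin q₂) ℂ :=
  -(P.WL X z * eval ((delayed p₂ q₂ (N + 1)).starProjection (toH2 (P.T X Y))) z * P.WR Y z)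

/-- The function `U(V) = Q_N - W_L P_{z^{-(N+1)}H2}(W_L⁻¹ V W_R⁻¹) W_R`. -/
def optU (X Y : Matrix (Fin n) (Fin n) ℝ) (N : ℕ) (V : H2 p₂ q₂) (z : ℂ) :
    Matrix (Fin p₂) (Fin q₂) ℂ :=
  P.QN X Y N z
    - P.WL X z * eval ((delayed p₂ q₂ (N + 1)).starProjection (toH2 (P.whiten X Y V))) z * P.WR Y z

/-- The cost `‖P₁₁ + P₁₂ V P₂₁ + P₁₂ U P₂₁‖` as a function of `U`, for fixed `V`. -/
def cost (V U : H2 p₂ q₂) : ℝ :=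
  ‖toH2 fun z => P.P₁₁ z + P.P₁₂ z * eval V z * P.P₂₁ z + P.P₁₂ z * eval U z * P.P₂₁ z‖

end Plant

end H2Model

end

noncomputable section

namespace H2Model

/-! ### Expansions determine elements of `H2` -/

/-! Substitute `V = W_L v W_R` and `U = W_L u W_R`. The map `u ↦ P₁₂ W_L u W_R P₂₁` is isometric on
strictly causal `u`, and its adjoint sends `P₁₁` to `T` up to terms orthogonal to every strictly
causal `u`. Hence completing the square gives `‖P₁₁ + P₁₂ (V + U) P₂₁‖² = ‖P₁₁‖² - ‖T‖² + ‖v + T +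
u‖²` (`Regular.cost_sq`).

The factors `W_L`, `W_R` and their inverses are all stable: the factors have state matrices `A +
B₂K` and `A + LC₂`, the inverses have `A` (up to transposition). So `u` runs over the same delayed
space as `U` (`Regular.exists_whiten`, `Regular.exists_unwhiten`), and the unique optimum is minus
the projection of `v + T` onto that space. Since `v` is strictly causal, the residual is `(T - P T)
+ P_𝒳 v`, with `P` the delayed projection. Expanding its square gives the cost formula, the cross
term being real because `T` and `v` have real coefficients.

The isometry and the adjoint are obtained in the time domain. A stable system is a solution in `H2`
of `x = z⁻¹(Ax + Bu)`. As `z⁻¹` is isometric and commutes with constant matrices, `⟨x, Xx⟩ = ⟨Ax +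
Bu, X(Ax + Bu)⟩`, and the Riccati equation turns this energy balance into the claim
(`norm_output_eq`, `inner_output_eq`). The factor `W_R P₂₁` is treated as the left factor of the
transposed plant (`Plant.dual`). -/

theorem norm_coeff_apply_le {p q : ℕ} (G : H2 p q) (i : ℕ) (a : Fin p) (b : Fin q) :
    ‖coeff G i a b‖ ≤ ‖G‖ :=
  (PiLp.norm_apply_le (G i) (a, b)).trans (lp.norm_apply_le_norm two_ne_zero G i)

theorem hasSum_eval {p q : ℕ} (G : H2 p q) {z : ℂ} (hz : 1 < ‖z‖) :
    HasSum (fun i => (z ^ i)⁻¹ • coeff G i) (eval G z) := by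
  refine Summable.hasSum (Pi.summable.2 fun a => Pi.summable.2 fun b => ?_)
  have hz' : ‖z‖⁻¹ < 1 := inv_lt_one_of_one_lt₀ hz
  refine Summable.of_norm_bounded
    (g := fun i => ‖z‖⁻¹ ^ i * ‖G‖)
    ((summable_geometric_of_lt_one (by positivity) hz').mul_right _) fun i => ?_
  rw [Matrix.smul_apply, norm_smul, norm_inv, norm_pow, inv_pow]
  gcongr
  exact norm_coeff_apply_le G i a b

theorem coeff_injective {p q : ℕ} {F G : H2 p q} (h : ∀ i, coeff F i = coeff G i) : F = G := by
  refine lp.ext (funext fun i => ?_)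
  ext ⟨a, b⟩
  exact congrFun (congrFun (h i) a) b

/-- A power series whose sum vanishes on a punctured disc has zero coefficients. -/
theorem eq_zero_of_hasSum_zero {c : ℕ → ℂ}
    (h : ∀ w : ℂ, w ≠ 0 → ‖w‖ < 1 → HasSum (fun i => w ^ i * c i) 0) : c = 0 := by
  classical
  -- At `w = 0` the series sums to `c 0`, not yet known to vanish, so `f` takes that value there.
  -- The identity theorem needs zeros only off the origin.
  let f : ℂ → ℂ := fun w => if w = 0 then c 0 else 0
  have hf : HasFPowerSeriesAt f (FormalMultilinearSeries.ofScalars ℂ c) 0 := by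
    rw [hasFPowerSeriesAt_iff]
    filter_upwards [Metric.ball_mem_nhds (0 : ℂ) one_pos] with w hw
    simp only [FormalMultilinearSeries.coeff_ofScalars, smul_eq_mul, zero_add]
    by_cases h0 : w = 0
    · subst h0
      simp only [f, if_true]
      have h1 := hasSum_single (f := fun i => (0 : ℂ) ^ i * c i) 0 fun i hi => by simp [hi]
      simpa using h1
    · simp only [f, if_neg h0]
      exact h w h0 (by simpa using hw)
  have hfreq : ∃ᶠ w in nhdsWithin (0 : ℂ) {0}ᶜ, f w = 0 := by
    refine Filter.Eventually.frequently ?_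
    filter_upwards [self_mem_nhdsWithin] with w hw
    exact if_neg hw
  have h0 := hf.eq_zero_of_eventually (hf.analyticAt.frequently_zero_iff_eventually_zero.1 hfreq)
  funext i
  have h1 := congrArg (fun p => FormalMultilinearSeries.coeff p i) h0
  rw [FormalMultilinearSeries.coeff_ofScalars] at h1
  exact h1.trans (by simp [FormalMultilinearSeries.coeff])

/-- With `w = z⁻¹` the expansions become power series on the punctured unit disc. -/
theorem eval_injective {p q : ℕ} {F G : H2 p q} (h : ∀ z : ℂ, 1 < ‖z‖ → eval F z = eval G z) :
    F = G := by
  refine coeff_injective fun i => ?_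
  ext a b
  have key : (fun i => coeff F i a b - coeff G i a b) = 0 := by
    refine eq_zero_of_hasSum_zero fun w hw hw1 => ?_
    have hz : 1 < ‖w⁻¹‖ := by
      rw [norm_inv]; exact (one_lt_inv₀ (norm_pos_iff.2 hw)).2 hw1
    have h1 := (hasSum_eval F hz).sub (hasSum_eval G hz)
    rw [h _ hz, sub_self] at h1
    have h2 := Pi.hasSum.1 (Pi.hasSum.1 h1 a) b
    simpa [mul_sub] using h2
  exact sub_eq_zero.1 (congrFun key i)

theorem hasExpansion_iff {p q : ℕ} {F : ℂ → Matrix (Fin p) (Fin q) ℂ} {G : H2 p q} :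
    HasExpansion F G ↔ ∀ z : ℂ, 1 < ‖z‖ → eval G z = F z :=
  ⟨fun h z hz => (hasSum_eval G hz).unique (h z hz), fun h z hz => h z hz ▸ hasSum_eval G hz⟩

theorem memH2_of_eval {p q : ℕ} {F : ℂ → Matrix (Fin p) (Fin q) ℂ} {G : H2 p q}
    (h : ∀ z : ℂ, 1 < ‖z‖ → eval G z = F z) : MemH2 F :=
  ⟨G, hasExpansion_iff.2 h⟩

/-- Removes the choice in `toH2`: any element with the right values on `|z| > 1` is the chosen one.
-/
theorem toH2_eq_of_eval {p q : ℕ} {F : ℂ → Matrix (Fin p) (Fin q) ℂ} {G : H2 p q}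
    (h : ∀ z : ℂ, 1 < ‖z‖ → eval G z = F z) : toH2 F = G := by
  have hF := memH2_of_eval h
  rw [toH2, dif_pos hF]
  exact eval_injective fun z hz => by rw [hasExpansion_iff.1 hF.choose_spec z hz, h z hz]

theorem eval_add {p q : ℕ} (F G : H2 p q) {z : ℂ} (hz : 1 < ‖z‖) :
    eval (F + G) z = eval F z + eval G z := by
  refine (hasSum_eval _ hz).unique ?_
  convert! (hasSum_eval F hz).add (hasSum_eval G hz) using 2 with i
  ext a b
  simp [coeff, mul_add]

theorem eval_neg {p q : ℕ} (F : H2 p q) {z : ℂ} (hz : 1 < ‖z‖) :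
    eval (-F) z = -eval F z := by
  refine (hasSum_eval _ hz).unique ?_
  convert! (hasSum_eval F hz).neg using 2 with i
  ext a b
  simp [coeff]

theorem eval_zero {p q : ℕ} (z : ℂ) : eval (0 : H2 p q) z = 0 := by
  have : ∀ i, coeff (0 : H2 p q) i = 0 := fun i => by ext a b; simp [coeff]
  simp [eval, this]

/-- The constant transfer matrix `M`. -/
def const {p q : ℕ} (M : Matrix (Fin p) (Fin q) ℂ) : H2 p q :=
  lp.single 2 0 (WithLp.toLp 2 fun ab => M ab.1 ab.2)

theorem coeff_const_zero {p q : ℕ} (M : Matrix (Fin p) (Fin q) ℂ) : coeff (const M) 0 = M := by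
  ext a b
  simp [coeff, const]

theorem const_apply_of_ne {p q : ℕ} (M : Matrix (Fin p) (Fin q) ℂ) {i : ℕ} (hi : i ≠ 0) :
    const M i = 0 := by
  rw [const, lp.single_apply_ne 2 0 _ hi]

theorem eval_const {p q : ℕ} (M : Matrix (Fin p) (Fin q) ℂ) {z : ℂ} (hz : 1 < ‖z‖) :
    eval (const M) z = M := by
  refine (hasSum_eval _ hz).unique ?_
  have h := hasSum_single (f := fun i => (z ^ i)⁻¹ • coeff (const M) i) 0 fun i hi => by
    ext a b
    simp [coeff, const_apply_of_ne M hi]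
  simpa [coeff_const_zero] using h

/-! ### Multiplication by constant matrices, delay and transposition -/

/-- Left multiplication by a constant matrix. -/
def leftMul {p q r : ℕ} (M : Matrix (Fin p) (Fin q) ℂ) : H2 q r →L[ℂ] H2 p r :=
  lp.mapCLM 2 (fun _ => LinearMap.toContinuousLinearMap
    ({ toFun := fun g => WithLp.toLp 2 fun ac => ∑ b, M ac.1 b * g (b, ac.2)
       map_add' := fun f g => by ext; simp [mul_add, Finset.sum_add_distrib]
       map_smul' := fun c g => by
        ext; simp [Finset.mul_sum, mul_left_comm] } :
      EuclideanSpace ℂ (Fin q × Fin r) →ₗ[ℂ] EuclideanSpace ℂ (Fin p × Fin r)))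
    (norm_nonneg _) fun _ => le_rfl

theorem leftMul_apply {p q r : ℕ} (M : Matrix (Fin p) (Fin q) ℂ) (G : H2 q r) (i : ℕ)
    (a : Fin p) (c : Fin r) : leftMul M G i (a, c) = ∑ b, M a b * G i (b, c) := rfl

theorem coeff_leftMul {p q r : ℕ} (M : Matrix (Fin p) (Fin q) ℂ) (G : H2 q r) (i : ℕ) :
    coeff (leftMul M G) i = M * coeff G i := by
  ext a c
  simp [coeff, leftMul_apply, Matrix.mul_apply]

theorem leftMul_mul {p q r s : ℕ} (M : Matrix (Fin p) (Fin q) ℂ) (M' : Matrix (Fin q) (Fin r) ℂ)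
    (G : H2 r s) : leftMul (M * M') G = leftMul M (leftMul M' G) :=
  coeff_injective fun i => by simp [coeff_leftMul, Matrix.mul_assoc]

theorem coeff_add {p q : ℕ} (F G : H2 p q) (i : ℕ) : coeff (F + G) i = coeff F i + coeff G i := by
  ext a b; simp [coeff]

theorem coeff_smul {p q : ℕ} (c : ℂ) (G : H2 p q) (i : ℕ) : coeff (c • G) i = c • coeff G i := by
  ext a b; simp [coeff]

theorem leftMul_add {p q r : ℕ} (M M' : Matrix (Fin p) (Fin q) ℂ) (G : H2 q r) :
    leftMul (M + M') G = leftMul M G + leftMul M' G :=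
  coeff_injective fun i => by simp [coeff_leftMul, coeff_add, Matrix.add_mul]

theorem leftMul_zero {p q r : ℕ} (G : H2 q r) :
    leftMul (0 : Matrix (Fin p) (Fin q) ℂ) G = 0 :=
  coeff_injective fun i => by rw [coeff_leftMul]; ext; simp [coeff]

theorem leftMul_one {p r : ℕ} (G : H2 p r) :
    leftMul (1 : Matrix (Fin p) (Fin p) ℂ) G = G :=
  coeff_injective fun i => by simp [coeff_leftMul]

/-- Left multiplication by square matrices as a homomorphism of algebras. -/
def leftMulHom (n r : ℕ) : Matrix (Fin n) (Fin n) ℂ →ₐ[ℂ] (H2 n r →L[ℂ] H2 n r) where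
  toFun := leftMul
  map_one' := ContinuousLinearMap.ext leftMul_one
  map_mul' M N := ContinuousLinearMap.ext (leftMul_mul M N)
  map_zero' := ContinuousLinearMap.ext leftMul_zero
  map_add' M N := ContinuousLinearMap.ext (leftMul_add M N)
  commutes' c := ContinuousLinearMap.ext fun G => coeff_injective fun i => by
    rw [coeff_leftMul, Algebra.algebraMap_eq_smul_one, Algebra.algebraMap_eq_smul_one]
    simp [coeff_smul]

theorem eval_leftMul {p q r : ℕ} (M : Matrix (Fin p) (Fin q) ℂ) (G : H2 q r) {z : ℂ}
    (hz : 1 < ‖z‖) : eval (leftMul M G) z = M * eval G z := by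
  refine (hasSum_eval _ hz).unique ?_
  convert! (hasSum_eval G hz).map (Matrix.addMonoidHomMulLeft M)
    (continuous_const.matrix_mul continuous_id) using 2 with i
  simp [coeff_leftMul]

theorem inner_leftMul_left {p q r : ℕ} (M : Matrix (Fin p) (Fin q) ℂ) (F : H2 q r) (G : H2 p r) :
    inner ℂ (leftMul M F) G = inner ℂ F (leftMul M.conjTranspose G) := by
  rw [inner_eq_tsum_trace, inner_eq_tsum_trace]
  refine tsum_congr fun i => ?_
  rw [coeff_leftMul, coeff_leftMul, Matrix.conjTranspose_mul, ← Matrix.mul_assoc,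
    Matrix.trace_mul_comm, ← Matrix.mul_assoc]

/-- The sequence `0, g 0, g 1, …`. -/
def shiftSeq {E : Type*} [Zero E] (g : ℕ → E) : ℕ → E
  | 0 => 0
  | i + 1 => g i

theorem memℓp_shiftSeq {p q : ℕ} (G : H2 p q) :
    Memℓp (shiftSeq fun i => (G i : EuclideanSpace ℂ (Fin p × Fin q))) 2 := by
  refine memℓp_gen ((summable_nat_add_iff 1).1 ?_)
  simpa [shiftSeq] using (lp.memℓp G).summable (by simp)

/-- Multiplication by `z⁻¹`. -/
def shift {p q : ℕ} : H2 p q →ₗᵢ[ℂ] H2 p q where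
  toFun G := ⟨shiftSeq fun i => G i, memℓp_shiftSeq G⟩
  map_add' F G := lp.ext (funext fun i => by cases i with
    | zero => exact (add_zero (0 : EuclideanSpace ℂ (Fin p × Fin q))).symm
    | succ i => rfl)
  map_smul' c G := lp.ext (funext fun i => by cases i <;> simp [shiftSeq])
  norm_map' G := by
    have h2 : (0 : ℝ) < ENNReal.toReal 2 := by simp
    refine (Real.rpow_left_inj (norm_nonneg _) (norm_nonneg _) h2.ne').1 ?_
    rw [lp.norm_rpow_eq_tsum h2, lp.norm_rpow_eq_tsum h2,
      ((lp.memℓp _).summable h2).tsum_eq_zero_add]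
    simp [shiftSeq]

theorem coeff_shift_succ {p q : ℕ} (G : H2 p q) (i : ℕ) : coeff (shift G) (i + 1) = coeff G i := rfl

theorem coeff_shift_zero {p q : ℕ} (G : H2 p q) : coeff (shift G) 0 = 0 := rfl

theorem eval_shift {p q : ℕ} (G : H2 p q) {z : ℂ} (hz : 1 < ‖z‖) :
    eval (shift G) z = z⁻¹ • eval G z := by
  refine (hasSum_eval _ hz).unique ((hasSum_nat_add_iff' 1).1 ?_)
  convert! (hasSum_eval G hz).const_smul z⁻¹ using 1
  · funext i
    rw [coeff_shift_succ, smul_smul, pow_succ', mul_inv]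
  · simp [coeff_shift_zero]

theorem leftMul_shift {p q r : ℕ} (M : Matrix (Fin p) (Fin q) ℂ) (G : H2 q r) :
    leftMul M (shift G) = shift (leftMul M G) :=
  coeff_injective fun i => by
    cases i <;> simp [coeff_leftMul, coeff_shift_succ, coeff_shift_zero]

/-- Transposition of transfer matrices. -/
def transp {p q : ℕ} (G : H2 p q) : H2 q p :=
  ⟨fun i => WithLp.toLp 2 fun ba => G i (ba.2, ba.1), by
    refine memℓp_gen ?_
    convert! (lp.memℓp G).summable (p := 2) (by simp) using 3 with i
    rw [EuclideanSpace.norm_eq, EuclideanSpace.norm_eq]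
    congr 1
    exact Equiv.sum_comp (Equiv.prodComm (Fin q) (Fin p)) fun ab => ‖G i ab‖ ^ 2⟩

theorem coeff_transp {p q : ℕ} (G : H2 p q) (i : ℕ) :
    coeff (transp G) i = (coeff G i).transpose := rfl

theorem eval_transp {p q : ℕ} (G : H2 p q) {z : ℂ} (hz : 1 < ‖z‖) :
    eval (transp G) z = (eval G z).transpose := by
  refine (hasSum_eval _ hz).unique ?_
  convert! (hasSum_eval G hz).matrix_transpose using 2 with i

theorem inner_transp {p q : ℕ} (F G : H2 p q) :
    inner ℂ (transp F) (transp G) = inner ℂ F G := by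
  rw [inner_eq_tsum_trace, inner_eq_tsum_trace]
  refine tsum_congr fun i => ?_
  rw [coeff_transp, coeff_transp, ← Matrix.trace_transpose, Matrix.transpose_mul,
    Matrix.trace_mul_comm]
  rfl

theorem norm_transp {p q : ℕ} (G : H2 p q) : ‖transp G‖ = ‖G‖ := by
  rw [@norm_eq_sqrt_re_inner ℂ, @norm_eq_sqrt_re_inner ℂ _ _ _ _ G, inner_transp]

theorem transp_transp {p q : ℕ} (G : H2 p q) : transp (transp G) = G := rfl

/-! ### Supports and real coefficients -/

theorem mem_delayed {p q k : ℕ} {G : H2 p q} :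
    G ∈ delayed p q k ↔ ∀ i < k, coeff G i = 0 := by
  refine ⟨fun h i hi => ?_, fun h i hi => ?_⟩
  · ext a b
    simp [coeff, h i (by simpa using hi)]
  · ext ⟨a, b⟩
    exact congrFun (congrFun (h i (by simpa using hi)) a) b

theorem transp_mem_delayed {p q k : ℕ} {G : H2 p q} (h : G ∈ delayed p q k) :
    transp G ∈ delayed q p k :=
  mem_delayed.2 fun i hi => by rw [coeff_transp, mem_delayed.1 h i hi, Matrix.transpose_zero]

theorem leftMul_mem_delayed {p q r k : ℕ} (M : Matrix (Fin p) (Fin q) ℂ) {G : H2 q r}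
    (h : G ∈ delayed q r k) : leftMul M G ∈ delayed p r k :=
  mem_delayed.2 fun i hi => by rw [coeff_leftMul, mem_delayed.1 h i hi, Matrix.mul_zero]

/-- All coefficient matrices are real. -/
def IsReal {p q : ℕ} (G : H2 p q) : Prop := ∀ i a b, (coeff G i a b).im = 0

theorem IsReal.leftMul {p q r : ℕ} (M : Matrix (Fin p) (Fin q) ℝ) {G : H2 q r} (h : IsReal G) :
    IsReal (leftMul (cpx M) G) := fun i a c => by
  simp [coeff_leftMul, Matrix.mul_apply, h i]

theorem IsReal.add {p q : ℕ} {F G : H2 p q} (hF : IsReal F) (hG : IsReal G) :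
    IsReal (F + G) := fun i a b => by
  simp [coeff_add, hF i, hG i]

theorem IsReal.transp {p q : ℕ} {G : H2 p q} (h : IsReal G) : IsReal (transp G) :=
  fun i a b => h i b a

theorem isReal_const {p q : ℕ} (M : Matrix (Fin p) (Fin q) ℝ) : IsReal (const (cpx M)) := by
  intro i a b
  by_cases hi : i = 0
  · simp [hi, coeff_const_zero]
  · simp [coeff, const_apply_of_ne _ hi]

theorem inner_im_eq_zero {p q : ℕ} {F G : H2 p q} (hF : IsReal F) (hG : IsReal G) :
    (inner ℂ F G).im = 0 := by
  rw [inner_eq_tsum_trace, ← Complex.conj_eq_iff_im, Complex.conj_tsum]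
  refine tsum_congr fun i => Complex.conj_eq_iff_im.2 ?_
  simp [Matrix.trace, Matrix.mul_apply, hF i, hG i]

/-! ### Stable realizations act on `H2` -/

theorem cpx_mul {l m n : ℕ} (M : Matrix (Fin l) (Fin m) ℝ) (N : Matrix (Fin m) (Fin n) ℝ) :
    cpx (M * N) = cpx M * cpx N :=
  Matrix.map_mul (f := Complex.ofRealHom)

theorem cpx_add {m n : ℕ} (M N : Matrix (Fin m) (Fin n) ℝ) : cpx (M + N) = cpx M + cpx N :=
  Matrix.map_add _ Complex.ofReal_add M N

theorem cpx_neg {m n : ℕ} (M : Matrix (Fin m) (Fin n) ℝ) : cpx (-M) = -cpx M := by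
  ext; simp

theorem cpx_zero {m n : ℕ} : cpx (0 : Matrix (Fin m) (Fin n) ℝ) = 0 := by
  ext; simp

theorem cpx_one {n : ℕ} : cpx (1 : Matrix (Fin n) (Fin n) ℝ) = 1 :=
  Matrix.map_one _ Complex.ofReal_zero Complex.ofReal_one

theorem cpx_transpose {m n : ℕ} (M : Matrix (Fin m) (Fin n) ℝ) :
    cpx M.transpose = (cpx M).transpose := rfl

theorem conjTranspose_cpx {m n : ℕ} (M : Matrix (Fin m) (Fin n) ℝ) :
    (cpx M).conjTranspose = cpx M.transpose := by
  ext; simp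

/-- Gelfand's formula: `‖a ^ k‖ ^ (1/k)` tends to the spectral radius, which is below 1. -/
theorem exists_norm_pow_lt_one {A : Type*} [NormedRing A] [NormedAlgebra ℂ A] [CompleteSpace A]
    (a : A) (h : ∀ μ ∈ spectrum ℂ a, ‖μ‖ < 1) : ∃ k : ℕ, 0 < k ∧ ‖a ^ k‖ < 1 := by
  -- The strict bound on the spectral radius uses that the spectrum is nonempty, which fails in the
  -- trivial algebra.
  rcases subsingleton_or_nontrivial A with hA | hA
  · exact ⟨1, one_pos, by simp [Subsingleton.elim (a ^ 1) 0]⟩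
  have hr : spectralRadius ℂ a < (1 : NNReal) :=
    spectrum.spectralRadius_lt_of_forall_lt a h
  have ht := spectrum.pow_nnnorm_pow_one_div_tendsto_nhds_spectralRadius a
  obtain ⟨k, hk, hk0⟩ := ((ht.eventually_lt_const hr).and (Filter.eventually_gt_atTop 0)).exists
  refine ⟨k, hk0, ?_⟩
  by_contra! hge
  refine hk.not_ge ?_
  rw [ENNReal.coe_one]
  exact ENNReal.one_le_rpow (by exact_mod_cast hge) (by positivity)

/-- The state equation of a stable system has a solution in `H2`. -/
theorem exists_state {n r : ℕ} {A : Matrix (Fin n) (Fin n) ℝ} (hA : IsStable A) (g : H2 n r) :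
    ∃ x : H2 n r, x = shift (leftMul (cpx A) x + g) := by
  let a : H2 n r →L[ℂ] H2 n r := leftMulHom n r (cpx A)
  let s : H2 n r →L[ℂ] H2 n r := (shift : H2 n r →ₗᵢ[ℂ] H2 n r).toContinuousLinearMap
  -- An algebra homomorphism does not enlarge the spectrum, so the operator of multiplication by `A`
  -- inherits the eigenvalue bound.
  obtain ⟨k, hk0, hk⟩ := exists_norm_pow_lt_one a fun μ hμ =>
    hA μ (AlgHom.spectrum_apply_subset (leftMulHom n r) (cpx A) hμ)
  have hcomm : Commute s a := ContinuousLinearMap.ext fun G => (leftMul_shift (cpx A) G).symm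
  have hs : ‖s‖ ≤ 1 := LinearIsometry.norm_toContinuousLinearMap_le _
  have hsa : ‖(s * a) ^ k‖ < 1 := by
    rw [hcomm.mul_pow]
    refine (norm_mul_le _ _).trans_lt (lt_of_le_of_lt ?_ hk)
    exact mul_le_of_le_one_left (norm_nonneg _)
      ((norm_pow_le' s hk0).trans (pow_le_one₀ (norm_nonneg _) hs))
  -- `1 - (sa)^k` is a unit and factors as `1 - sa` times a commuting geometric sum, so `1 - sa` is
  -- a unit.
  have hunit : IsUnit (1 - s * a) := by
    have h1 : IsUnit (1 - (s * a) ^ k) := isUnit_one_sub_of_norm_lt_one hsa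
    rw [← mul_neg_geom_sum] at h1
    refine (Commute.isUnit_mul_iff ?_).1 h1 |>.1
    exact (mul_neg_geom_sum (s * a) k).trans (geom_sum_mul_neg (s * a) k).symm
  obtain ⟨b, hb⟩ := hunit.exists_right_inv
  refine ⟨b (s g), ?_⟩
  have h1 := congrArg (fun f : H2 n r →L[ℂ] H2 n r => f (s g)) hb
  have h2 : b (s g) - s (a (b (s g))) = s g := h1
  rw [sub_eq_iff_eq_add] at h2
  rw [map_add, add_comm]
  exact h2

theorem IsStable.isUnit {n : ℕ} {A : Matrix (Fin n) (Fin n) ℝ} (hA : IsStable A) {z : ℂ}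
    (hz : 1 < ‖z‖) : IsUnit (z • (1 : Matrix (Fin n) (Fin n) ℂ) - cpx A) := by
  by_contra h
  refine (hA z ?_).not_gt hz
  rwa [spectrum.mem_iff, Algebra.algebraMap_eq_smul_one]

theorem IsStable.transpose {n : ℕ} {A : Matrix (Fin n) (Fin n) ℝ} (hA : IsStable A) :
    IsStable A.transpose := by
  intro μ hμ
  refine hA μ ?_
  rw [spectrum.mem_iff, Algebra.algebraMap_eq_smul_one] at hμ ⊢
  rwa [← Matrix.isUnit_transpose, Matrix.transpose_sub, Matrix.transpose_smul,
    Matrix.transpose_one]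

theorem eval_state {n r : ℕ} {A : Matrix (Fin n) (Fin n) ℝ} (hA : IsStable A) {x g : H2 n r}
    (hx : x = shift (leftMul (cpx A) x + g)) {z : ℂ} (hz : 1 < ‖z‖) :
    eval x z = (z • (1 : Matrix (Fin n) (Fin n) ℂ) - cpx A)⁻¹ * eval g z := by
  have hz0 : z ≠ 0 := norm_pos_iff.1 (one_pos.trans hz)
  have h1 : eval x z = z⁻¹ • (cpx A * eval x z + eval g z) := by
    conv_lhs => rw [hx]
    rw [eval_shift _ hz, eval_add _ _ hz, eval_leftMul _ _ hz]
  have h2 : (z • (1 : Matrix (Fin n) (Fin n) ℂ) - cpx A) * eval x z = eval g z := by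
    rw [Matrix.sub_mul, Matrix.smul_mul, Matrix.one_mul]
    nth_rewrite 1 [h1]
    rw [smul_smul, mul_inv_cancel₀ hz0, one_smul, add_sub_cancel_left]
  rw [← h2, Matrix.nonsing_inv_mul_cancel_left _ _
    ((Matrix.isUnit_iff_isUnit_det _).1 (hA.isUnit hz))]

/-- The state equation reads `x₀ = 0`, `x_{i+1} = A x_i + g_i`, so the state lags its input by one
step. -/
theorem state_mem_delayed {n r k : ℕ} {A : Matrix (Fin n) (Fin n) ℂ} {x g : H2 n r}
    (hx : x = shift (leftMul A x + g)) (hg : g ∈ delayed n r k) :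
    x ∈ delayed n r (k + 1) := by
  refine mem_delayed.2 fun i => ?_
  induction i with
  | zero => intro _; rw [hx, coeff_shift_zero]
  | succ i ih =>
    intro hi
    rw [hx, coeff_shift_succ, coeff_add, coeff_leftMul, ih (by omega),
      mem_delayed.1 hg i (by omega), Matrix.mul_zero, add_zero]

theorem isReal_state {n r : ℕ} {A : Matrix (Fin n) (Fin n) ℝ} {x g : H2 n r}
    (hx : x = shift (leftMul (cpx A) x + g)) (hg : IsReal g) : IsReal x := by
  intro i
  induction i with
  | zero => intro a b; rw [hx, coeff_shift_zero]; rfl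
  | succ i ih =>
    intro a b
    rw [hx, coeff_shift_succ, coeff_add, coeff_leftMul]
    simp [Matrix.mul_apply, ih, hg i]

theorem delayed_succ_le {p q k : ℕ} : delayed p q (k + 1) ≤ delayed p q k := fun _ h =>
  mem_delayed.2 fun i hi => mem_delayed.1 h i (by omega)

theorem eval_output {n m k r : ℕ} {A : Matrix (Fin n) (Fin n) ℝ} (hA : IsStable A)
    {B : Matrix (Fin n) (Fin m) ℝ} (C : Matrix (Fin k) (Fin n) ℝ) (D : Matrix (Fin k) (Fin m) ℝ)
    {x : H2 n r} {u : H2 m r} (hx : x = shift (leftMul (cpx A) x + leftMul (cpx B) u)) {z : ℂ}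
    (hz : 1 < ‖z‖) :
    eval (leftMul (cpx C) x + leftMul (cpx D) u) z = realization A B C D z * eval u z := by
  rw [eval_add _ _ hz, eval_leftMul _ _ hz, eval_leftMul _ _ hz, eval_state hA hx hz,
    eval_leftMul _ _ hz, realization, Matrix.add_mul]
  simp only [Matrix.mul_assoc]

/-- Multiplication by a stable transfer matrix from the left. -/
theorem exists_realization_mul {n m k r : ℕ} {A : Matrix (Fin n) (Fin n) ℝ} (hA : IsStable A)
    (B : Matrix (Fin n) (Fin m) ℝ) (C : Matrix (Fin k) (Fin n) ℝ) (D : Matrix (Fin k) (Fin m) ℝ)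
    (u : H2 m r) :
    ∃ y : H2 k r, (∀ z : ℂ, 1 < ‖z‖ → eval y z = realization A B C D z * eval u z) ∧
      (∀ j, u ∈ delayed m r j → y ∈ delayed k r j) ∧ (IsReal u → IsReal y) := by
  obtain ⟨x, hx⟩ := exists_state hA (leftMul (cpx B) u)
  refine ⟨leftMul (cpx C) x + leftMul (cpx D) u, fun z hz => eval_output hA C D hx hz,
    fun j hu => Submodule.add_mem _ (leftMul_mem_delayed _ ?_) (leftMul_mem_delayed _ hu),
    fun hu => ((isReal_state hx (hu.leftMul B)).leftMul C).add (hu.leftMul D)⟩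
  exact delayed_succ_le (state_mem_delayed hx (leftMul_mem_delayed _ hu))

theorem realization_transpose {n m k : ℕ} (A : Matrix (Fin n) (Fin n) ℝ)
    (B : Matrix (Fin n) (Fin m) ℝ) (C : Matrix (Fin k) (Fin n) ℝ) (D : Matrix (Fin k) (Fin m) ℝ)
    (z : ℂ) :
    (realization A B C D z).transpose =
      realization A.transpose C.transpose B.transpose D.transpose z := by
  simp [realization, cpx_transpose, Matrix.transpose_nonsing_inv, Matrix.mul_assoc]

/-- Multiplication by a stable transfer matrix from the right. -/
theorem exists_mul_realization {n m k r : ℕ} {A : Matrix (Fin n) (Fin n) ℝ} (hA : IsStable A)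
    (B : Matrix (Fin n) (Fin m) ℝ) (C : Matrix (Fin k) (Fin n) ℝ) (D : Matrix (Fin k) (Fin m) ℝ)
    (u : H2 r k) :
    ∃ y : H2 r m, (∀ z : ℂ, 1 < ‖z‖ → eval y z = eval u z * realization A B C D z) ∧
      (∀ j, u ∈ delayed r k j → y ∈ delayed r m j) ∧ (IsReal u → IsReal y) := by
  obtain ⟨y, h1, h2, h3⟩ := exists_realization_mul hA.transpose C.transpose B.transpose
    D.transpose (transp u)
  refine ⟨transp y, fun z hz => ?_, fun j hu => transp_mem_delayed (h2 j (transp_mem_delayed hu)),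
    fun hu => (h3 hu.transp).transp⟩
  rw [eval_transp _ hz, h1 z hz, eval_transp _ hz, ← realization_transpose,
    ← Matrix.transpose_mul, Matrix.transpose_transpose]

/-- A stable transfer matrix is in `H2`. -/
theorem exists_realization {n m k : ℕ} {A : Matrix (Fin n) (Fin n) ℝ} (hA : IsStable A)
    (B : Matrix (Fin n) (Fin m) ℝ) (C : Matrix (Fin k) (Fin n) ℝ) (D : Matrix (Fin k) (Fin m) ℝ) :
    ∃ y : H2 k m, (∀ z : ℂ, 1 < ‖z‖ → eval y z = realization A B C D z) ∧ IsReal y := by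
  obtain ⟨y, h1, -, h3⟩ := exists_realization_mul hA B C D (const (cpx (1 : Matrix (Fin m) (Fin m) ℝ)))
  refine ⟨y, fun z hz => ?_, h3 (isReal_const 1)⟩
  rw [h1 z hz, eval_const _ hz, cpx_one, Matrix.mul_one]

/-! ### Energy balance -/

theorem inner_leftMul_leftMul {p q r s : ℕ} (M : Matrix (Fin p) (Fin q) ℝ)
    (N : Matrix (Fin p) (Fin s) ℝ) (F : H2 q r) (G : H2 s r) :
    inner ℂ (leftMul (cpx M) F) (leftMul (cpx N) G) =
      inner ℂ F (leftMul (cpx (M.transpose * N)) G) := by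
  rw [inner_leftMul_left, conjTranspose_cpx, ← leftMul_mul, ← cpx_mul]

theorem leftMul_cpx_add {p q r : ℕ} (M N : Matrix (Fin p) (Fin q) ℝ) (G : H2 q r) :
    leftMul (cpx (M + N)) G = leftMul (cpx M) G + leftMul (cpx N) G := by
  rw [cpx_add, leftMul_add]

theorem inner_shift_leftMul_shift {n r : ℕ} (X : Matrix (Fin n) (Fin n) ℂ) (v w : H2 n r) :
    inner ℂ (shift v) (leftMul X (shift w)) = inner ℂ v (leftMul X w) := by
  rw [leftMul_shift, LinearIsometry.inner_map_map]

theorem inner_const_right_eq_zero {p q : ℕ} {G : H2 p q} (hG : G ∈ delayed p q 1)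
    (M : Matrix (Fin p) (Fin q) ℂ) : inner ℂ G (const M) = 0 := by
  rw [const, lp.inner_single_right, hG 0 (by simp), inner_zero_left]

theorem leftMul_const {p q r : ℕ} (M : Matrix (Fin p) (Fin q) ℂ) (N : Matrix (Fin q) (Fin r) ℂ) :
    leftMul M (const N) = const (M * N) := by
  refine coeff_injective fun i => ?_
  rw [coeff_leftMul]
  by_cases hi : i = 0
  · simp [hi, coeff_const_zero]
  · have h (p q : ℕ) (M : Matrix (Fin p) (Fin q) ℂ) : coeff (const M) i = 0 := by
      ext a b; simp [coeff, const_apply_of_ne M hi]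
    rw [h, h, Matrix.mul_zero]

/-- The three equations are the blocks of `[C D]ᵀ[C D] + [A B]ᵀ X [A B] = diag(X, 1)`. Evaluated at
`(x, u)`, the stored energy `⟨x, Xx⟩` cancels against that of `Ax + Bu`, because `x` is the shift of
the latter. -/
theorem norm_output_eq {n m k r : ℕ} {A X : Matrix (Fin n) (Fin n) ℝ}
    {B : Matrix (Fin n) (Fin m) ℝ} {C : Matrix (Fin k) (Fin n) ℝ} {D : Matrix (Fin k) (Fin m) ℝ}
    (hXs : X.IsSymm)
    (h1 : C.transpose * C + A.transpose * (X * A) = X)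
    (h2 : D.transpose * C + B.transpose * (X * A) = 0)
    (h3 : D.transpose * D + B.transpose * (X * B) = 1)
    {x : H2 n r} {u : H2 m r} (hx : x = shift (leftMul (cpx A) x + leftMul (cpx B) u)) :
    ‖leftMul (cpx C) x + leftMul (cpx D) u‖ = ‖u‖ := by
  have h4 : C.transpose * D + A.transpose * (X * B) = 0 := by
    simpa [hXs.eq, Matrix.mul_assoc] using congrArg Matrix.transpose h2
  have hX : inner ℂ x (leftMul (cpx X) x) = inner ℂ (leftMul (cpx A) x + leftMul (cpx B) u)
      (leftMul (cpx X) (leftMul (cpx A) x + leftMul (cpx B) u)) := by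
    conv_lhs => rw [hx]
    exact inner_shift_leftMul_shift _ _ _
  have e1 := congrArg (fun M => inner ℂ x (leftMul (cpx M) x)) h1
  have e2 := congrArg (fun M => inner ℂ u (leftMul (cpx M) x)) h2
  have e3 := congrArg (fun M => inner ℂ u (leftMul (cpx M) u)) h3
  have e4 := congrArg (fun M => inner ℂ x (leftMul (cpx M) u)) h4
  simp only [leftMul_cpx_add, cpx_zero, cpx_one, leftMul_zero, leftMul_one, inner_add_right,
    inner_zero_right] at e1 e2 e3 e4
  simp only [map_add, inner_add_right, inner_add_left, ← leftMul_mul, ← cpx_mul,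
    inner_leftMul_leftMul] at hX
  have key : inner ℂ (leftMul (cpx C) x + leftMul (cpx D) u)
      (leftMul (cpx C) x + leftMul (cpx D) u) = inner ℂ u u := by
    simp only [inner_add_right, inner_add_left, inner_leftMul_leftMul]
    linear_combination e1 + e2 + e3 + e4 + hX
  rw [@norm_eq_sqrt_re_inner ℂ, @norm_eq_sqrt_re_inner ℂ _ _ _ _ u, key]

/-- Polarized energy balance between a system driven by `u` and one driven by the impulse `M`. The
impulse contributes `⟨Ax + Bu, XM⟩`, which vanishes since `Ax + Bu` has no constant term. This
computes the causal part of an adjoint. -/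
theorem inner_output_eq {n m k r : ℕ} {A A' X : Matrix (Fin n) (Fin n) ℝ}
    {B : Matrix (Fin n) (Fin m) ℝ} {C C' : Matrix (Fin k) (Fin n) ℝ}
    {D : Matrix (Fin k) (Fin m) ℝ} {E : Matrix (Fin m) (Fin n) ℝ} {M : Matrix (Fin n) (Fin r) ℂ}
    (h1 : C.transpose * C' + A.transpose * (X * A') = X)
    (h2 : D.transpose * C' + B.transpose * (X * A') = E)
    {x ξ : H2 n r} {u : H2 m r} (hx : x = shift (leftMul (cpx A) x + leftMul (cpx B) u))
    (hu : u ∈ delayed m r 1) (hξ : ξ = shift (leftMul (cpx A') ξ + const M)) :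
    inner ℂ (leftMul (cpx C) x + leftMul (cpx D) u) (leftMul (cpx C') ξ) =
      inner ℂ u (leftMul (cpx E) ξ) := by
  have hx1 : x ∈ delayed n r 1 :=
    delayed_succ_le (state_mem_delayed hx (leftMul_mem_delayed _ hu))
  have hX : inner ℂ x (leftMul (cpx X) ξ) = inner ℂ (leftMul (cpx A) x + leftMul (cpx B) u)
      (leftMul (cpx X) (leftMul (cpx A') ξ + const M)) := by
    conv_lhs => rw [hx, hξ]
    exact inner_shift_leftMul_shift _ _ _
  rw [map_add, inner_add_right, leftMul_const, inner_const_right_eq_zero (Submodule.add_mem _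
    (leftMul_mem_delayed _ hx1) (leftMul_mem_delayed _ hu)), add_zero] at hX
  have e1 := congrArg (fun M => inner ℂ x (leftMul (cpx M) ξ)) h1
  have e2 := congrArg (fun M => inner ℂ u (leftMul (cpx M) ξ)) h2
  simp only [leftMul_cpx_add, inner_add_right] at e1 e2
  simp only [inner_add_left, ← leftMul_mul, ← cpx_mul, inner_leftMul_leftMul] at hX
  simp only [inner_add_left, inner_leftMul_leftMul]
  linear_combination e1 + e2 + hX

theorem inner_const_const {p q : ℕ} (M N : Matrix (Fin p) (Fin q) ℂ) :
    inner ℂ (const M) (const N) = (N * M.conjTranspose).trace := by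
  rw [inner_eq_tsum_trace, tsum_eq_single 0, coeff_const_zero, coeff_const_zero]
  intro i hi
  have : coeff (const N) i = 0 := by ext a b; simp [coeff, const_apply_of_ne N hi]
  rw [this, Matrix.zero_mul, Matrix.trace_zero]

/-- The solution of a Lyapunov equation of a stable matrix is positive semidefinite. -/
theorem posSemidef_of_lyapunov {n k : ℕ} {A X : Matrix (Fin n) (Fin n) ℝ}
    {C : Matrix (Fin k) (Fin n) ℝ} (hA : IsStable A) (hXs : X.IsSymm)
    (h : C.transpose * C + A.transpose * (X * A) = X) : X.PosSemidef := by
  refine Matrix.PosSemidef.of_dotProduct_mulVec_nonneg hXs fun v => ?_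
  let M : Matrix (Fin n) (Fin 1) ℝ := Matrix.of fun i _ => v i
  -- The free response to the initial vector `v`: the energy balance yields `vᵀXv = ‖Cx‖²`.
  obtain ⟨x, hx⟩ := exists_state hA (const (cpx M))
  have hx1 : x ∈ delayed n 1 1 := state_mem_delayed hx (mem_delayed.2 fun i hi => by omega)
  have hX : inner ℂ x (leftMul (cpx X) x) = inner ℂ (leftMul (cpx A) x + const (cpx M))
      (leftMul (cpx X) (leftMul (cpx A) x + const (cpx M))) := by
    conv_lhs => rw [hx]
    exact inner_shift_leftMul_shift _ _ _
  have h0 : inner ℂ (const (cpx M)) (leftMul (cpx X) (leftMul (cpx A) x)) = 0 := by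
    rw [← inner_conj_symm, inner_const_right_eq_zero (leftMul_mem_delayed _
      (leftMul_mem_delayed _ hx1)), map_zero]
  have e1 := congrArg (fun M => inner ℂ x (leftMul (cpx M) x)) h
  simp only [leftMul_cpx_add, inner_add_right] at e1
  rw [map_add, inner_add_left, inner_add_right, inner_add_right, h0, leftMul_const,
    inner_const_right_eq_zero (leftMul_mem_delayed _ hx1), ← leftMul_mul, ← cpx_mul,
    inner_leftMul_leftMul, inner_const_const] at hX
  have key : (cpx X * cpx M * (cpx M).conjTranspose).trace =
      inner ℂ (leftMul (cpx C) x) (leftMul (cpx C) x) := by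
    rw [inner_leftMul_leftMul]
    linear_combination -hX - e1
  have hv : (cpx X * cpx M * (cpx M).conjTranspose).trace = ((v ⬝ᵥ X.mulVec v : ℝ) : ℂ) := by
    simp [Matrix.trace, Matrix.mul_apply, M, dotProduct, Matrix.mulVec, mul_comm]
  rw [hv] at key
  have := congrArg Complex.re key
  rw [Complex.ofReal_re] at this
  rw [star_trivial, this]
  exact inner_self_nonneg (𝕜 := ℂ)

namespace Plant

variable {n p₁ p₂ q₁ q₂ : ℕ} (P : Plant n p₁ p₂ q₁ q₂)

/-! ### The control Riccati equation -/

section Riccati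

variable {P} {X : Matrix (Fin n) (Fin n) ℝ}

theorem Omega_transpose (hX : X.IsSymm) : (P.Omega X).transpose = P.Omega X := by
  simp [Omega, hX.eq, Matrix.mul_assoc]

/-- Pairs the closed loop on the left with the open loop on the right. It holds without
invertibility of `Ω`, and is the form needed both for the adjoint of `P₁₂ W_L` and for the
positivity of `Ω`. -/
theorem IsControlRiccati.eq_half (h : P.IsControlRiccati X) :
    (P.C₁ + P.D₁₂ * P.gainK X).transpose * P.C₁
      + (P.A + P.B₂ * P.gainK X).transpose * (X * P.A) = X := by
  have hK : (P.gainK X).transpose =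
      -((P.A.transpose * X * P.B₂ + P.C₁.transpose * P.D₁₂) * (P.Omega X)⁻¹) := by
    simp [gainK, Matrix.transpose_nonsing_inv, Omega_transpose h.1, h.1.eq, Matrix.mul_assoc]
  conv_rhs => rw [h.2.1]
  rw [Matrix.transpose_add, Matrix.transpose_add, Matrix.transpose_mul, Matrix.transpose_mul, hK]
  simp only [Matrix.add_mul, Matrix.mul_add, Matrix.neg_mul, Matrix.mul_assoc]
  abel

theorem posDef_Omega (hD : (P.D₁₂.transpose * P.D₁₂).PosDef) (hX : X.PosSemidef) :
    (P.Omega X).PosDef :=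
  hD.add_posSemidef (by simpa using hX.conjTranspose_mul_mul_same P.B₂)

theorem Omega_mul_gainK (hΩ : IsUnit (P.Omega X)) :
    P.Omega X * P.gainK X = -(P.B₂.transpose * X * P.A + P.D₁₂.transpose * P.C₁) := by
  rw [gainK, Matrix.mul_neg, Matrix.mul_nonsing_inv_cancel_left _ _
    ((Matrix.isUnit_iff_isUnit_det _).1 hΩ)]

theorem feedthrough_eq_zero (hΩ : IsUnit (P.Omega X)) :
    P.D₁₂.transpose * (P.C₁ + P.D₁₂ * P.gainK X)
      + P.B₂.transpose * (X * (P.A + P.B₂ * P.gainK X)) = 0 := by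
  have h1 := Omega_mul_gainK hΩ
  rw [Omega, Matrix.add_mul, ← sub_eq_zero] at h1
  rw [← h1]
  simp only [Matrix.mul_add, Matrix.mul_assoc]
  abel

/-- The mixed form plus the transposed feedthrough identity multiplied by `K`. -/
theorem IsControlRiccati.eq_closedLoop (h : P.IsControlRiccati X) (hΩ : IsUnit (P.Omega X)) :
    (P.C₁ + P.D₁₂ * P.gainK X).transpose * (P.C₁ + P.D₁₂ * P.gainK X)
      + (P.A + P.B₂ * P.gainK X).transpose * (X * (P.A + P.B₂ * P.gainK X)) = X := by
  have h1 := congrArg (fun M => Matrix.transpose M * P.gainK X) (feedthrough_eq_zero hΩ)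
  simp only [Matrix.transpose_add, Matrix.transpose_mul, Matrix.transpose_zero, Matrix.zero_mul,
    Matrix.transpose_transpose, h.1.eq] at h1
  conv_rhs => rw [← h.eq_half, ← add_zero (_ + _), ← h1]
  simp only [Matrix.transpose_add, Matrix.transpose_mul, Matrix.mul_add, Matrix.add_mul,
    Matrix.mul_assoc]
  abel

/-- In either case `X` solves a Lyapunov equation of a stable matrix, hence `X ≥ 0` and `Ω ≥ D₁₂ᵀD₁₂
> 0`. -/
theorem IsControlRiccati.posDef_Omega (h : P.IsControlRiccati X) (hA : IsStable P.A)
    (hD : (P.D₁₂.transpose * P.D₁₂).PosDef) : (P.Omega X).PosDef := by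
  refine Plant.posDef_Omega hD ?_
  by_cases hΩ : IsUnit (P.Omega X)
  · exact posSemidef_of_lyapunov h.2.2 h.1 (h.eq_closedLoop hΩ)
  -- A singular `Ω` has inverse `0` by convention, so the gain vanishes and the Riccati equation
  -- becomes the Lyapunov equation of `A`.
  · have hK : P.gainK X = 0 := by
      rw [gainK, Matrix.nonsing_inv_apply_not_isUnit _
        (mt (Matrix.isUnit_iff_isUnit_det _).2 hΩ), Matrix.zero_mul, neg_zero]
    have h1 := h.eq_half
    simp only [hK, Matrix.mul_zero, add_zero] at h1
    exact posSemidef_of_lyapunov hA h.1 h1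

end Riccati

theorem sqrt_mul_sqrt {m : ℕ} {Ω : Matrix (Fin m) (Fin m) ℝ} (hΩ : Ω.PosDef) :
    CFC.sqrt Ω * CFC.sqrt Ω = Ω :=
  CFC.sqrt_mul_sqrt_self Ω hΩ.posSemidef.nonneg

theorem isUnit_det_sqrt {m : ℕ} {Ω : Matrix (Fin m) (Fin m) ℝ} (hΩ : Ω.PosDef) :
    IsUnit (CFC.sqrt Ω).det := by
  have h := (Matrix.isUnit_iff_isUnit_det _).1 hΩ.isUnit
  rw [← sqrt_mul_sqrt hΩ, Matrix.det_mul] at h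
  exact isUnit_of_mul_isUnit_left h

theorem sqrt_transpose {m : ℕ} (Ω : Matrix (Fin m) (Fin m) ℝ) :
    (CFC.sqrt Ω).transpose = CFC.sqrt Ω :=
  (Matrix.nonneg_iff_posSemidef.1 (CFC.sqrt_nonneg Ω)).isHermitian

/-! ### The left spectral factor -/

theorem realization_mul_cpx {n m k l : ℕ} (A : Matrix (Fin n) (Fin n) ℝ)
    (B : Matrix (Fin n) (Fin m) ℝ) (C : Matrix (Fin k) (Fin n) ℝ) (D : Matrix (Fin k) (Fin m) ℝ)
    (M : Matrix (Fin m) (Fin l) ℝ) (z : ℂ) :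
    realization A B C D z * cpx M = realization A (B * M) C (D * M) z := by
  simp only [realization, cpx_mul, Matrix.add_mul, Matrix.mul_assoc]

theorem cpx_mul_realization {n m k l : ℕ} (A : Matrix (Fin n) (Fin n) ℝ)
    (B : Matrix (Fin n) (Fin m) ℝ) (C : Matrix (Fin k) (Fin n) ℝ) (D : Matrix (Fin k) (Fin m) ℝ)
    (M : Matrix (Fin l) (Fin k) ℝ) (z : ℂ) :
    cpx M * realization A B C D z = realization A B (M * C) (M * D) z := by
  simp only [realization, cpx_mul, Matrix.mul_add, Matrix.mul_assoc]

/-- Resolvent identity: `BK` is the difference of the two matrices being inverted. -/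
theorem resolvent_feedback {n m : ℕ} {A : Matrix (Fin n) (Fin n) ℝ} {B : Matrix (Fin n) (Fin m) ℝ}
    {K : Matrix (Fin m) (Fin n) ℝ} (hA : IsStable A) (hAK : IsStable (A + B * K)) {z : ℂ}
    (hz : 1 < ‖z‖) :
    (z • (1 : Matrix (Fin n) (Fin n) ℂ) - cpx A)⁻¹ * (cpx B * (cpx K *
        (z • (1 : Matrix (Fin n) (Fin n) ℂ) - cpx (A + B * K))⁻¹)) =
      (z • (1 : Matrix (Fin n) (Fin n) ℂ) - cpx (A + B * K))⁻¹ -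
        (z • (1 : Matrix (Fin n) (Fin n) ℂ) - cpx A)⁻¹ ∧
    (z • (1 : Matrix (Fin n) (Fin n) ℂ) - cpx (A + B * K))⁻¹ * (cpx B * (cpx K *
        (z • (1 : Matrix (Fin n) (Fin n) ℂ) - cpx A)⁻¹)) =
      (z • (1 : Matrix (Fin n) (Fin n) ℂ) - cpx (A + B * K))⁻¹ -
        (z • (1 : Matrix (Fin n) (Fin n) ℂ) - cpx A)⁻¹ := by
  have h1 := (Matrix.isUnit_iff_isUnit_det _).1 (hA.isUnit hz)
  have h2 := (Matrix.isUnit_iff_isUnit_det _).1 (hAK.isUnit hz)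
  set e := z • (1 : Matrix (Fin n) (Fin n) ℂ) - cpx A
  set f := z • (1 : Matrix (Fin n) (Fin n) ℂ) - cpx (A + B * K) with hf
  have hBK : cpx B * cpx K = e - f := by
    rw [hf, cpx_add, cpx_mul]; simp only [e]; abel
  constructor
  · rw [← Matrix.mul_assoc (cpx B), hBK, Matrix.sub_mul, Matrix.mul_sub,
      Matrix.mul_nonsing_inv _ h2, Matrix.mul_one, Matrix.nonsing_inv_mul_cancel_left _ _ h1]
  · rw [← Matrix.mul_assoc (cpx B), hBK, Matrix.sub_mul, Matrix.mul_sub,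
      Matrix.mul_nonsing_inv _ h1, Matrix.mul_one, Matrix.nonsing_inv_mul_cancel_left _ _ h2]

theorem realization_mul_feedback {n m k : ℕ} {A : Matrix (Fin n) (Fin n) ℝ}
    {B : Matrix (Fin n) (Fin m) ℝ} {K : Matrix (Fin m) (Fin n) ℝ} (hA : IsStable A)
    (hAK : IsStable (A + B * K)) (C : Matrix (Fin k) (Fin n) ℝ) (D : Matrix (Fin k) (Fin m) ℝ)
    {z : ℂ} (hz : 1 < ‖z‖) :
    realization A B C D z * realization (A + B * K) B K 1 z =
      realization (A + B * K) B (C + D * K) D z := by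
  have h := congrArg (fun M => cpx C * (M * cpx B)) (resolvent_feedback hA hAK hz).1
  simp only [Matrix.sub_mul, Matrix.mul_sub, Matrix.mul_assoc] at h
  simp only [realization, cpx_one, Matrix.mul_add, Matrix.add_mul, Matrix.mul_one,
    Matrix.mul_assoc, h]
  rw [cpx_add C, cpx_mul, Matrix.add_mul, Matrix.mul_assoc]
  abel

theorem feedback_mul_realization {n m : ℕ} {A : Matrix (Fin n) (Fin n) ℝ}
    {B : Matrix (Fin n) (Fin m) ℝ} {K : Matrix (Fin m) (Fin n) ℝ} (hA : IsStable A)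
    (hAK : IsStable (A + B * K)) {z : ℂ} (hz : 1 < ‖z‖) :
    realization (A + B * K) B K 1 z * realization A B (-K) 1 z = 1 := by
  have h := congrArg (fun M => cpx K * (M * cpx B)) (resolvent_feedback hA hAK hz).2
  simp only [Matrix.sub_mul, Matrix.mul_sub, Matrix.mul_assoc] at h
  simp only [realization, cpx_one, cpx_neg, Matrix.mul_add, Matrix.add_mul, Matrix.mul_one,
    Matrix.one_mul, Matrix.mul_assoc, Matrix.neg_mul, Matrix.mul_neg, h]
  abel

section Left

variable {P} {X : Matrix (Fin n) (Fin n) ℝ}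

theorem WL_eq (z : ℂ) : P.WL X z = realization (P.A + P.B₂ * P.gainK X)
    (P.B₂ * (CFC.sqrt (P.Omega X))⁻¹) (P.gainK X) (CFC.sqrt (P.Omega X))⁻¹ z := by
  rw [WL, realization_mul_cpx, Matrix.one_mul]

theorem WL_mul_inverse (hA : IsStable P.A) (hX : P.IsControlRiccati X)
    (hΩ : (P.Omega X).PosDef) {z : ℂ} (hz : 1 < ‖z‖) :
    P.WL X z * realization P.A P.B₂ (CFC.sqrt (P.Omega X) * (-P.gainK X))
      (CFC.sqrt (P.Omega X)) z = 1 := by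
  have h := cpx_mul_realization P.A P.B₂ (-P.gainK X) 1 (CFC.sqrt (P.Omega X)) z
  rw [Matrix.mul_one] at h
  rw [← h, WL, Matrix.mul_assoc, ← Matrix.mul_assoc (cpx _) (cpx _), ← cpx_mul,
    Matrix.nonsing_inv_mul _ (isUnit_det_sqrt hΩ), cpx_one, Matrix.one_mul,
    feedback_mul_realization hA hX.2.2 hz]

theorem WL_inv (hA : IsStable P.A) (hX : P.IsControlRiccati X)
    (hΩ : (P.Omega X).PosDef) {z : ℂ} (hz : 1 < ‖z‖) :
    (P.WL X z)⁻¹ = realization P.A P.B₂ (CFC.sqrt (P.Omega X) * (-P.gainK X))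
      (CFC.sqrt (P.Omega X)) z :=
  Matrix.inv_eq_right_inv (WL_mul_inverse hA hX hΩ hz)

theorem isUnit_WL (hA : IsStable P.A) (hX : P.IsControlRiccati X)
    (hΩ : (P.Omega X).PosDef) {z : ℂ} (hz : 1 < ‖z‖) : IsUnit (P.WL X z).det :=
  Matrix.isUnit_det_of_right_inverse (WL_mul_inverse hA hX hΩ hz)

theorem P₁₂_mul_WL (hA : IsStable P.A) (hX : P.IsControlRiccati X) {z : ℂ} (hz : 1 < ‖z‖) :
    P.P₁₂ z * P.WL X z = realization (P.A + P.B₂ * P.gainK X)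
      (P.B₂ * (CFC.sqrt (P.Omega X))⁻¹) (P.C₁ + P.D₁₂ * P.gainK X)
      (P.D₁₂ * (CFC.sqrt (P.Omega X))⁻¹) z := by
  rw [P₁₂, WL, ← Matrix.mul_assoc, realization_mul_feedback hA hX.2.2 _ _ hz, realization_mul_cpx]

/-- `P₁₂ W_L` acts isometrically, and its adjoint maps `C₁ (zI - A)⁻¹ M` to
`-Ω^{1/2} K (zI - A)⁻¹ M`, up to an anticausal term. -/
theorem exists_P₁₂_mul_WL_mul (hA : IsStable P.A) (hX : P.IsControlRiccati X)
    (hΩ : (P.Omega X).PosDef) {r : ℕ} (u : H2 p₂ r) :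
    ∃ y : H2 q₁ r, (∀ z : ℂ, 1 < ‖z‖ → eval y z = P.P₁₂ z * P.WL X z * eval u z) ∧
      (∀ j, u ∈ delayed p₂ r j → y ∈ delayed q₁ r j) ∧ ‖y‖ = ‖u‖ ∧
      (u ∈ delayed p₂ r 1 → ∀ (M : Matrix (Fin n) (Fin r) ℝ) (h : H2 q₁ r) (t : H2 p₂ r),
        (∀ z : ℂ, 1 < ‖z‖ → eval h z = realization P.A M P.C₁ 0 z) →
        (∀ z : ℂ, 1 < ‖z‖ →
          eval t z = realization P.A M (CFC.sqrt (P.Omega X) * P.gainK X) 0 z) →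
        inner ℂ y h = -inner ℂ u t) := by
  set W := CFC.sqrt (P.Omega X) with hW
  have hdet : IsUnit W.det := isUnit_det_sqrt hΩ
  have hWT : W⁻¹.transpose = W⁻¹ := by rw [Matrix.transpose_nonsing_inv, sqrt_transpose]
  have hWW : W⁻¹ * P.Omega X = W := by
    rw [← sqrt_mul_sqrt hΩ, Matrix.nonsing_inv_mul_cancel_left _ _ hdet]
  obtain ⟨x, hx⟩ := exists_state hX.2.2 (leftMul (cpx (P.B₂ * W⁻¹)) u)
  refine ⟨leftMul (cpx (P.C₁ + P.D₁₂ * P.gainK X)) x + leftMul (cpx (P.D₁₂ * W⁻¹)) u,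
    fun z hz => ?_, fun j hu => ?_, ?_, fun hu M h t hh ht => ?_⟩
  · rw [P₁₂_mul_WL hA hX hz, eval_output hX.2.2 _ _ hx hz]
  · exact Submodule.add_mem _ (leftMul_mem_delayed _ (delayed_succ_le
      (state_mem_delayed hx (leftMul_mem_delayed _ hu)))) (leftMul_mem_delayed _ hu)
  -- Inputs are scaled by `Ω^{-1/2}`: the cross block vanishes as before, and the input block
  -- becomes `Ω^{-1/2} Ω Ω^{-1/2} = 1`.
  · refine norm_output_eq hX.1 (hX.eq_closedLoop hΩ.isUnit) ?_ ?_ hx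
    · rw [Matrix.transpose_mul, Matrix.transpose_mul, Matrix.mul_assoc, Matrix.mul_assoc,
        ← Matrix.mul_add, feedthrough_eq_zero hΩ.isUnit, Matrix.mul_zero]
    · have h1 : W⁻¹ * P.Omega X * W⁻¹ = 1 := by rw [hWW, Matrix.mul_nonsing_inv _ hdet]
      rw [← h1, Matrix.transpose_mul, Matrix.transpose_mul, hWT, Omega]
      simp only [Matrix.mul_add, Matrix.add_mul, Matrix.mul_assoc]
  -- `ξ = (zI - A)⁻¹ M` is the common open-loop state of `h` and `t`.
  · obtain ⟨ξ, hξ⟩ := exists_state hA (const (cpx M))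
    have hξz {z : ℂ} (hz : 1 < ‖z‖) := eval_state hA hξ hz
    have hh' : h = leftMul (cpx P.C₁) ξ := eval_injective fun z hz => by
      rw [hh z hz, eval_leftMul _ _ hz, hξz hz, eval_const _ hz, realization, cpx_zero, add_zero,
        Matrix.mul_assoc]
    have ht' : -t = leftMul (cpx (-(W * P.gainK X))) ξ := eval_injective fun z hz => by
      rw [eval_neg _ hz, ht z hz, eval_leftMul _ _ hz, hξz hz, eval_const _ hz, realization,
        cpx_zero, add_zero, cpx_neg, Matrix.neg_mul, Matrix.mul_assoc]
    rw [← inner_neg_right, hh', ht']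
    refine inner_output_eq hX.eq_half ?_ hx hu hξ
    -- The input block is now `Ω^{-1/2}(D₁₂ᵀC₁ + B₂ᵀXA) = -Ω^{-1/2} Ω K = -Ω^{1/2} K`.
    have h2 : W * P.gainK X = W⁻¹ * (P.Omega X * P.gainK X) := by
      rw [← Matrix.mul_assoc, hWW]
    rw [h2, Omega_mul_gainK hΩ.isUnit, Matrix.transpose_mul, Matrix.transpose_mul, hWT]
    simp only [Matrix.mul_neg, neg_neg, Matrix.mul_add, Matrix.mul_assoc]
    abel

end Left

/-! ### The dual plant -/

/-- The plant with transposed transfer matrices. -/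
def dual : Plant n q₁ q₂ p₁ p₂ where
  A := P.A.transpose
  B₁ := P.C₁.transpose
  B₂ := P.C₂.transpose
  C₁ := P.B₁.transpose
  C₂ := P.B₂.transpose
  D₁₂ := P.D₂₁.transpose
  D₂₁ := P.D₁₂.transpose

section Right

variable {P} {Y : Matrix (Fin n) (Fin n) ℝ}

theorem dual_Omega : P.dual.Omega Y = P.Psi Y := by
  simp [Omega, Psi, dual]

theorem dual_gainK (hY : Y.IsSymm) : P.dual.gainK Y = (P.gainL Y).transpose := by
  have h := Omega_transpose (P := P.dual) hY
  rw [dual_Omega] at h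
  rw [gainK, gainL, dual_Omega, Matrix.transpose_neg, Matrix.transpose_mul,
    Matrix.transpose_nonsing_inv, h]
  simp [dual, hY.eq, Matrix.mul_assoc]

theorem IsEstimationRiccati.dual (h : P.IsEstimationRiccati Y) : P.dual.IsControlRiccati Y := by
  refine ⟨h.1, ?_, ?_⟩
  · conv_lhs => rw [h.2.1]
    rw [dual_Omega]
    simp [Plant.dual]
  · rw [dual_gainK h.1]
    have h1 := h.2.2.transpose
    simpa [Plant.dual] using h1

theorem dual_P₁₂ (z : ℂ) : P.dual.P₁₂ z = (P.P₂₁ z).transpose := by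
  rw [P₂₁, realization_transpose]; rfl

theorem dual_WL (hY : Y.IsSymm) (z : ℂ) : P.dual.WL Y z = (P.WR Y z).transpose := by
  rw [WL, WR, Matrix.transpose_mul, realization_transpose, dual_gainK hY, dual_Omega,
    ← cpx_transpose, Matrix.transpose_nonsing_inv, sqrt_transpose]
  simp [dual]

theorem isUnit_WR (hA : IsStable P.A) (hY : P.IsEstimationRiccati Y)
    (hΨ : (P.Psi Y).PosDef) {z : ℂ} (hz : 1 < ‖z‖) : IsUnit (P.WR Y z).det := by
  rw [← Matrix.det_transpose, ← dual_WL hY.1]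
  exact isUnit_WL hA.transpose hY.dual (by rwa [dual_Omega]) hz

end Right

end Plant

/-! ### Projections onto supports -/

open Classical in
theorem starProjection_supportedOn_apply {p q : ℕ} (s : Set ℕ) (v : H2 p q) (i : ℕ) :
    (supportedOn p q s).starProjection v i = if i ∈ s then v i else 0 := by
  let w : H2 p q := ⟨fun i => if i ∈ s then v i else 0, by
    refine memℓp_gen (Summable.of_nonneg_of_le (fun i => by positivity) (fun i => ?_)
      ((lp.memℓp v).summable (p := 2) (by simp)))
    split_ifs
    · exact le_rfl
    · simp⟩
  have hw (i : ℕ) : w i = if i ∈ s then v i else 0 := rfl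
  rw [Submodule.eq_starProjection_of_mem_of_inner_eq_zero (K := supportedOn p q s) (u := v)
    (v := w) (fun i hi => by rw [hw, if_neg hi]) fun u hu => ?_, hw]
  rw [lp.inner_eq_tsum]
  refine (tsum_congr fun i => ?_).trans tsum_zero
  by_cases hi : i ∈ s
  · simp [hw, hi]
  · simp [hu i hi]

/-- The index sets `[1, N]` and `[N+1, ∞)` miss only index 0, where `v` vanishes. -/
theorem starProjection_firSpace {p q N : ℕ} {v : H2 p q} (hv : v ∈ delayed p q 1) :
    (firSpace p q N).starProjection v = v - (delayed p q (N + 1)).starProjection v := by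
  refine lp.ext (funext fun i => ?_)
  rw [lp.coeFn_sub, Pi.sub_apply, starProjection_supportedOn_apply,
    starProjection_supportedOn_apply]
  by_cases h0 : i = 0
  · simp [h0, hv 0 (by simp)]
  · by_cases h1 : i ≤ N
    · rw [if_pos ⟨by omega, h1⟩, if_neg (by simpa using Nat.lt_succ_of_le h1), sub_zero]
    · rw [if_neg fun h => h1 h.2, if_pos (by simp; omega), sub_self]

theorem isReal_starProjection {p q : ℕ} (s : Set ℕ) {v : H2 p q} (hv : IsReal v) :
    IsReal ((supportedOn p q s).starProjection v) := fun i a b => by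
  classical
  have h := hv i a b
  rw [coeff, Matrix.of_apply] at h ⊢
  rw [starProjection_supportedOn_apply]
  split_ifs
  · exact h
  · simp

/-! ### The closed-loop map in whitened parameters -/

namespace Plant

variable {n p₁ p₂ q₁ q₂ : ℕ} {P : Plant n p₁ p₂ q₁ q₂} {X Y : Matrix (Fin n) (Fin n) ℝ}

/-- A stable plant with stabilizing solutions of its two Riccati equations and positive definite
`Ω` and `Ψ`. -/
structure Regular (P : Plant n p₁ p₂ q₁ q₂) (X Y : Matrix (Fin n) (Fin n) ℝ) : Prop where
  stable : IsStable P.A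
  control : P.IsControlRiccati X
  estimation : P.IsEstimationRiccati Y
  posDef_Omega : (P.Omega X).PosDef
  posDef_Psi : (P.Psi Y).PosDef

namespace Regular

theorem exists_T (h : P.Regular X Y) :
    ∃ t : H2 p₂ q₂, (∀ z : ℂ, 1 < ‖z‖ → eval t z = P.T X Y z) ∧ IsReal t := by
  obtain ⟨t, ht, htr⟩ := exists_realization h.stable (P.gainL Y * CFC.sqrt (P.Psi Y))
    (CFC.sqrt (P.Omega X) * P.gainK X) 0
  refine ⟨t, fun z hz => ?_, htr⟩
  rw [ht z hz, T, cpx_mul_realization, realization_mul_cpx, Matrix.mul_zero, Matrix.zero_mul]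

theorem exists_P₁₁ (h : P.Regular X Y) :
    ∃ g : H2 q₁ p₁, ∀ z : ℂ, 1 < ‖z‖ → eval g z = P.P₁₁ z := by
  obtain ⟨g, hg, -⟩ := exists_realization h.stable P.B₁ P.C₁ 0
  exact ⟨g, hg⟩

/-- The left factor acts by the control Riccati equation, the right one by that of the dual plant,
after transposition. -/
theorem exists_closedLoop (h : P.Regular X Y) {g : H2 q₁ p₁} {t : H2 p₂ q₂}
    (hg : ∀ z : ℂ, 1 < ‖z‖ → eval g z = P.P₁₁ z)
    (ht : ∀ z : ℂ, 1 < ‖z‖ → eval t z = P.T X Y z) {u : H2 p₂ q₂} (hu : u ∈ delayed p₂ q₂ 1) :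
    ∃ y : H2 q₁ p₁,
      (∀ z : ℂ, 1 < ‖z‖ →
        eval y z = P.P₁₂ z * (P.WL X z * eval u z * P.WR Y z) * P.P₂₁ z) ∧
      ‖y‖ = ‖u‖ ∧ inner ℂ y g = inner ℂ u t := by
  have hΨ : (P.dual.Omega Y).PosDef := by rw [dual_Omega]; exact h.posDef_Psi
  obtain ⟨w, hw1, hw2, hw3, hw4⟩ := exists_P₁₂_mul_WL_mul (P := P.dual) h.stable.transpose
    h.estimation.dual hΨ (transp u)
  obtain ⟨y, hy1, -, hy3, hy4⟩ := exists_P₁₂_mul_WL_mul h.stable h.control h.posDef_Omega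
    (transp w)
  have hu' := transp_mem_delayed hu
  -- The intermediate point between `P₁₁` and `T`: the left adjoint has replaced `C₁` by `Ω^{1/2}K`,
  -- up to a sign that the right adjoint cancels.
  obtain ⟨s, hs, -⟩ := exists_realization h.stable P.B₁ (CFC.sqrt (P.Omega X) * P.gainK X) 0
  refine ⟨y, fun z hz => ?_, by rw [hy3, norm_transp, hw3, norm_transp], ?_⟩
  · rw [hy1 z hz, eval_transp _ hz, hw1 z hz, eval_transp _ hz, dual_P₁₂,
      dual_WL h.estimation.1, ← Matrix.transpose_mul, ← Matrix.transpose_mul,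
      Matrix.transpose_transpose]
    simp only [Matrix.mul_assoc]
  · rw [hy4 (transp_mem_delayed (hw2 1 hu')) P.B₁ g s hg hs, ← inner_transp, transp_transp,
      hw4 hu' (CFC.sqrt (P.Omega X) * P.gainK X).transpose (transp s) (transp t), neg_neg,
      inner_transp]
    · intro z hz
      rw [eval_transp _ hz, hs z hz, realization_transpose, Matrix.transpose_zero]
      rfl
    · intro z hz
      rw [eval_transp _ hz, ht z hz, T, cpx_mul_realization, realization_mul_cpx,
        realization_transpose, dual_Omega, dual_gainK h.estimation.1, Matrix.mul_zero,
        Matrix.zero_mul, Matrix.transpose_zero, Matrix.transpose_mul (P.gainL Y), sqrt_transpose]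
      rfl

/-- `W_L⁻¹` and `W_R⁻¹` are realized with `A` and `Aᵀ`, so whitening is causal and maps each delayed
space into itself. -/
theorem exists_whiten (h : P.Regular X Y) (V : H2 p₂ q₂) :
    ∃ v : H2 p₂ q₂, (∀ z : ℂ, 1 < ‖z‖ → eval v z = P.whiten X Y V z) ∧
      (∀ j, V ∈ delayed p₂ q₂ j → v ∈ delayed p₂ q₂ j) ∧ (IsReal V → IsReal v) := by
  have hΨ : (P.dual.Omega Y).PosDef := by rw [dual_Omega]; exact h.posDef_Psi
  obtain ⟨w, hw1, hw2, hw3⟩ := exists_realization_mul h.stable P.B₂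
    (CFC.sqrt (P.Omega X) * (-P.gainK X)) (CFC.sqrt (P.Omega X)) V
  obtain ⟨v, hv1, hv2, hv3⟩ := exists_realization_mul h.stable.transpose P.dual.B₂
    (CFC.sqrt (P.dual.Omega Y) * (-P.dual.gainK Y)) (CFC.sqrt (P.dual.Omega Y)) (transp w)
  refine ⟨transp v, fun z hz => ?_,
    fun j hV => transp_mem_delayed (hv2 j (transp_mem_delayed (hw2 j hV))),
    fun hV => (hv3 (hw3 hV).transp).transp⟩
  have h1 := WL_inv (P := P.dual) h.stable.transpose h.estimation.dual hΨ hz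
  rw [dual_WL h.estimation.1, ← Matrix.transpose_nonsing_inv] at h1
  have h2 := WL_inv h.stable h.control h.posDef_Omega hz
  rw [eval_transp _ hz, hv1 z hz, eval_transp _ hz, hw1 z hz, whiten, h2,
    ← Matrix.transpose_transpose (P.WR Y z)⁻¹, h1, Matrix.transpose_mul,
    Matrix.transpose_transpose]
  rfl

theorem exists_unwhiten (h : P.Regular X Y) (u : H2 p₂ q₂) :
    ∃ U : H2 p₂ q₂, (∀ z : ℂ, 1 < ‖z‖ → eval U z = P.WL X z * eval u z * P.WR Y z) ∧
      (∀ j, u ∈ delayed p₂ q₂ j → U ∈ delayed p₂ q₂ j) := by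
  obtain ⟨w, hw1, hw2, -⟩ := exists_realization_mul h.control.2.2
    (P.B₂ * (CFC.sqrt (P.Omega X))⁻¹) (P.gainK X) (CFC.sqrt (P.Omega X))⁻¹ u
  obtain ⟨U, hU1, hU2, -⟩ := exists_mul_realization h.estimation.2.2 (P.gainL Y)
    ((CFC.sqrt (P.Psi Y))⁻¹ * P.C₂) (CFC.sqrt (P.Psi Y))⁻¹ w
  refine ⟨U, fun z hz => ?_, fun j hu => hU2 j (hw2 j hu)⟩
  rw [hU1 z hz, hw1 z hz, WL_eq, WR, cpx_mul_realization, Matrix.mul_one]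

theorem eval_eq_of_whiten (h : P.Regular X Y) (V : H2 p₂ q₂) {z : ℂ} (hz : 1 < ‖z‖) :
    P.WL X z * P.whiten X Y V z * P.WR Y z = eval V z := by
  rw [whiten, Matrix.mul_assoc (P.WL X z)⁻¹, Matrix.mul_nonsing_inv_cancel_left _ _
    (isUnit_WL h.stable h.control h.posDef_Omega hz), Matrix.nonsing_inv_mul_cancel_right _ _
    (isUnit_WR h.stable h.estimation (by exact h.posDef_Psi) hz)]

/-- Completion of squares: in the whitened parameters the cost is a shifted squared norm. -/
theorem cost_sq (h : P.Regular X Y) {g : H2 q₁ p₁} {t v u V U : H2 p₂ q₂}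
    (hg : ∀ z : ℂ, 1 < ‖z‖ → eval g z = P.P₁₁ z)
    (ht : ∀ z : ℂ, 1 < ‖z‖ → eval t z = P.T X Y z)
    (hv : v ∈ delayed p₂ q₂ 1) (hu : u ∈ delayed p₂ q₂ 1)
    (hV : ∀ z : ℂ, 1 < ‖z‖ → eval V z = P.WL X z * eval v z * P.WR Y z)
    (hU : ∀ z : ℂ, 1 < ‖z‖ → eval U z = P.WL X z * eval u z * P.WR Y z) :
    (MemH2 fun z => P.P₁₁ z + P.P₁₂ z * eval V z * P.P₂₁ z + P.P₁₂ z * eval U z * P.P₂₁ z) ∧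
    P.cost V U ^ 2 = ‖g‖ ^ 2 - ‖t‖ ^ 2 + ‖v + t + u‖ ^ 2 := by
  obtain ⟨y, hy1, hy2, hy3⟩ := h.exists_closedLoop hg ht (Submodule.add_mem _ hv hu)
  have hy : ∀ z : ℂ, 1 < ‖z‖ → eval (g + y) z =
      P.P₁₁ z + P.P₁₂ z * eval V z * P.P₂₁ z + P.P₁₂ z * eval U z * P.P₂₁ z := fun z hz => by
    rw [eval_add _ _ hz, hg z hz, hy1 z hz, eval_add _ _ hz, hV z hz, hU z hz]
    simp only [Matrix.mul_add, Matrix.add_mul]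
    abel
  refine ⟨memH2_of_eval hy, ?_⟩
  rw [cost, toH2_eq_of_eval hy, add_comm g y, @norm_add_sq ℂ, hy2, hy3,
    show v + t + u = (v + u) + t by abel, @norm_add_sq ℂ _ _ _ _ (v + u) t]
  ring

end Regular

/-- In a Hilbert space, `-P_S f` is the point of `S` closest to `-f`. -/
theorem norm_add_sq_eq_starProjection {E : Type*} [NormedAddCommGroup E] [InnerProductSpace ℂ E]
    (S : Submodule ℂ E) [S.HasOrthogonalProjection] (f : E) {u : E} (hu : u ∈ S) :
    ‖f + u‖ ^ 2 = ‖f - S.starProjection f‖ ^ 2 + ‖u + S.starProjection f‖ ^ 2 := by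
  have h0 : inner ℂ (f - S.starProjection f) (u + S.starProjection f) = 0 :=
    S.starProjection_inner_eq_zero f _ (S.add_mem hu (S.starProjection_apply_mem f))
  have h1 : f + u = (f - S.starProjection f) + (u + S.starProjection f) := by abel
  rw [h1, @norm_add_sq ℂ, h0]
  simp

/-! ### Minimization over the delayed component -/

namespace Regular

/-- The optimal delayed component and its cost, in terms of `v = W_L⁻¹ V W_R⁻¹` and `T`. -/
theorem optU_isUniqueMinimizerOn (h : P.Regular X Y) {g : H2 q₁ p₁} {t v V : H2 p₂ q₂} (N : ℕ)
    (hg : ∀ z : ℂ, 1 < ‖z‖ → eval g z = P.P₁₁ z)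
    (ht : ∀ z : ℂ, 1 < ‖z‖ → eval t z = P.T X Y z)
    (hV1 : V ∈ delayed p₂ q₂ 1)
    (hv : ∀ z : ℂ, 1 < ‖z‖ → eval v z = P.whiten X Y V z) :
    MemH2 (P.optU X Y N V) ∧
    (∀ U ∈ delayed p₂ q₂ (N + 1),
      MemH2 fun z => P.P₁₁ z + P.P₁₂ z * eval V z * P.P₂₁ z + P.P₁₂ z * eval U z * P.P₂₁ z) ∧
    IsUniqueMinimizerOn (P.cost V) (delayed p₂ q₂ (N + 1) : Set (H2 p₂ q₂))
      (toH2 (P.optU X Y N V)) ∧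
    P.cost V (toH2 (P.optU X Y N V)) ^ 2 = ‖g‖ ^ 2 - ‖t‖ ^ 2
      + ‖v + t - (delayed p₂ q₂ (N + 1)).starProjection (v + t)‖ ^ 2 := by
  set S := delayed p₂ q₂ (N + 1) with hS
  have hS1 : S ≤ delayed p₂ q₂ 1 := fun G hG => mem_delayed.2 fun i hi =>
    mem_delayed.1 hG i (by omega)
  have hv1 : v ∈ delayed p₂ q₂ 1 := by
    obtain ⟨v', hv', hd, -⟩ := h.exists_whiten V
    rw [eval_injective fun z hz => (hv z hz).trans (hv' z hz).symm]
    exact hd 1 hV1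
  have hVv : ∀ z : ℂ, 1 < ‖z‖ → eval V z = P.WL X z * eval v z * P.WR Y z := fun z hz => by
    rw [hv z hz, h.eval_eq_of_whiten V hz]
  let u₀ : H2 p₂ q₂ := -S.starProjection (v + t)
  have hu₀ : u₀ ∈ S := S.neg_mem (S.starProjection_apply_mem _)
  obtain ⟨U₀, hU₀, hU₀d⟩ := h.exists_unwhiten u₀
  have hopt : ∀ z : ℂ, 1 < ‖z‖ → eval U₀ z = P.optU X Y N V z := fun z hz => by
    rw [hU₀ z hz, optU, QN, toH2_eq_of_eval ht, toH2_eq_of_eval hv]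
    simp only [u₀]
    rw [map_add, eval_neg _ hz, eval_add _ _ hz]
    simp only [Matrix.mul_neg, Matrix.neg_mul, Matrix.mul_add, Matrix.add_mul, hS]
    abel
  rw [toH2_eq_of_eval hopt]
  -- Every competitor is parametrized by a delayed `u`, so the minimum over `U` is a minimum over `u
  -- ∈ S`.
  have hcost : ∀ U ∈ S, ∃ u ∈ S,
      (∀ z : ℂ, 1 < ‖z‖ → eval U z = P.WL X z * eval u z * P.WR Y z) := fun U hU => by
    obtain ⟨u, hu, hud, -⟩ := h.exists_whiten U
    exact ⟨u, hud _ hU, fun z hz => by rw [hu z hz, h.eval_eq_of_whiten U hz]⟩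
  have hcost₀ : P.cost V U₀ ^ 2 = ‖g‖ ^ 2 - ‖t‖ ^ 2
      + ‖v + t - S.starProjection (v + t)‖ ^ 2 := by
    rw [(h.cost_sq hg ht hv1 (hS1 hu₀) hVv hU₀).2, norm_add_sq_eq_starProjection S (v + t) hu₀]
    simp [u₀]
  refine ⟨memH2_of_eval hopt, fun U hU => ?_, ⟨hU₀d _ hu₀, fun U hU hne => ?_⟩, hcost₀⟩
  · obtain ⟨u, hu, hUu⟩ := hcost U hU
    exact (h.cost_sq hg ht hv1 (hS1 hu) hVv hUu).1
  · obtain ⟨u, hu, hUu⟩ := hcost U hU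
    have hune : u + S.starProjection (v + t) ≠ 0 := fun h0 => hne <| by
      have : u = u₀ := eq_neg_of_add_eq_zero_left h0
      exact eval_injective fun z hz => by rw [hUu z hz, hU₀ z hz, this]
    refine lt_of_pow_lt_pow_left₀ 2 (norm_nonneg _) ?_
    rw [hcost₀, (h.cost_sq hg ht hv1 (hS1 hu) hVv hUu).2,
      norm_add_sq_eq_starProjection S (v + t) hu]
    have := norm_pos_iff.2 hune
    have := pow_pos this 2
    linarith

end Regular

theorem cost_zero (P : Plant n p₁ p₂ q₁ q₂) :
    P.cost 0 = fun Q => ‖toH2 (P.closedLoop (eval Q))‖ := by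
  funext Q
  simp only [cost, eval_zero, Matrix.mul_zero, Matrix.zero_mul, add_zero]
  rfl

theorem whiten_zero (P : Plant n p₁ p₂ q₁ q₂) (X Y : Matrix (Fin n) (Fin n) ℝ) (z : ℂ) :
    P.whiten X Y 0 z = 0 := by
  simp [whiten, eval_zero]

theorem optU_zero (P : Plant n p₁ p₂ q₁ q₂) (X Y : Matrix (Fin n) (Fin n) ℝ) (N : ℕ) :
    P.optU X Y N 0 = P.QN X Y N := by
  have h : toH2 (P.whiten X Y 0) = 0 :=
    toH2_eq_of_eval fun z _ => by rw [eval_zero, whiten_zero]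
  funext z
  simp [optU, h, eval_zero]

end Plant

end H2Model

end

theorem mainTheorem2 {n p₁ p₂ q₁ q₂ : ℕ} (P : H2Model.Plant n p₁ p₂ q₁ q₂)
    (hA : H2Model.IsStable P.A)
    (hD₁₂ : (P.D₁₂.transpose * P.D₁₂).PosDef)
    (hD₂₁ : (P.D₂₁ * P.D₂₁.transpose).PosDef)
    (X Y : Matrix (Fin n) (Fin n) ℝ)
    (hX : P.IsControlRiccati X) (hY : P.IsEstimationRiccati Y)
    (N : ℕ) (hN : 1 ≤ N)
    (𝒴 : Submodule ℝ (H2Model.H2 p₂ q₂)) (h𝒴 : 𝒴 ≤ H2Model.realFirSpace p₂ q₂ N) :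
    -- `T` and `Q_N` are in `H2`, and `Q_N` is the unique solution of the delayed centralized problem
    H2Model.MemH2 (P.T X Y) ∧
    H2Model.MemH2 (P.QN X Y N) ∧
    (∀ Q ∈ H2Model.delayed p₂ q₂ (N + 1),
      H2Model.MemH2 (P.closedLoop (H2Model.eval Q))) ∧
    H2Model.IsUniqueMinimizerOn
      (fun Q => ‖H2Model.toH2 (P.closedLoop (H2Model.eval Q))‖)
      (H2Model.delayed p₂ q₂ (N + 1) : Set (H2Model.H2 p₂ q₂))
      (H2Model.toH2 (P.QN X Y N)) ∧
    ∀ V ∈ 𝒴,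
      H2Model.MemH2 (P.whiten X Y V) ∧
      H2Model.MemH2 (P.optU X Y N V) ∧
      (∀ U ∈ H2Model.delayed p₂ q₂ (N + 1),
        H2Model.MemH2 fun z => P.P₁₁ z + P.P₁₂ z * H2Model.eval V z * P.P₂₁ z
          + P.P₁₂ z * H2Model.eval U z * P.P₂₁ z) ∧
      -- `U(V)` is the unique optimal delayed component
      H2Model.IsUniqueMinimizerOn (P.cost V)
        (H2Model.delayed p₂ q₂ (N + 1) : Set (H2Model.H2 p₂ q₂))
        (H2Model.toH2 (P.optU X Y N V)) ∧
      -- the optimal cost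
      ((P.cost V (H2Model.toH2 (P.optU X Y N V)) ^ 2 : ℝ) : ℂ) =
        ((‖H2Model.toH2 (P.closedLoop (P.QN X Y N))‖ ^ 2 : ℝ) : ℂ)
        + ((‖(H2Model.firSpace p₂ q₂ N).starProjection
              (H2Model.toH2 (P.whiten X Y V))‖ ^ 2 : ℝ) : ℂ)
        + 2 * inner ℂ (H2Model.toH2 (P.T X Y))
            ((H2Model.firSpace p₂ q₂ N).starProjection (H2Model.toH2 (P.whiten X Y V))) := by
  have hR : P.Regular X Y := by
    refine ⟨hA, hX, hY, hX.posDef_Omega hA hD₁₂, ?_⟩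
    have h := hY.dual.posDef_Omega hA.transpose (by simpa [H2Model.Plant.dual] using hD₂₁)
    rwa [H2Model.Plant.dual_Omega] at h
  obtain ⟨g, hg⟩ := hR.exists_P₁₁
  obtain ⟨t, ht, htr⟩ := hR.exists_T
  -- The delayed centralized problem is the case `V = 0`.
  obtain ⟨hQ, hQcl, hQmin, hQcost⟩ := hR.optU_isUniqueMinimizerOn (v := 0) (V := 0) N hg ht
    (Submodule.zero_mem _) fun z _ => by
      rw [H2Model.eval_zero, H2Model.Plant.whiten_zero]
  rw [H2Model.Plant.optU_zero] at hQ hQmin hQcost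
  rw [H2Model.Plant.cost_zero] at hQmin hQcost
  have hQcl' : ∀ Q ∈ H2Model.delayed p₂ q₂ (N + 1),
      H2Model.MemH2 (P.closedLoop (H2Model.eval Q)) := fun Q hQd => by
    have h := hQcl Q hQd
    simp only [H2Model.eval_zero, Matrix.mul_zero, Matrix.zero_mul, add_zero] at h
    exact h
  refine ⟨H2Model.memH2_of_eval ht, hQ, hQcl', hQmin, fun V hV => ?_⟩
  have hV1 : V ∈ H2Model.delayed p₂ q₂ 1 := fun i hi =>
    (h𝒴 hV).1 i fun h => hi h.1
  obtain ⟨v, hv, hvd, hvr⟩ := hR.exists_whiten V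
  obtain ⟨hU, hUcl, hUmin, hUcost⟩ := hR.optU_isUniqueMinimizerOn N hg ht hV1 hv
  refine ⟨H2Model.memH2_of_eval hv, hU, hUcl, hUmin, ?_⟩
  -- `Q_N` is a bare function here. It agrees with its `H2` element only on `|z| > 1`, which
  -- suffices to identify the two closed loops.
  have hclosed : ‖H2Model.toH2 (P.closedLoop (P.QN X Y N))‖ ^ 2 =
      ‖g‖ ^ 2 - ‖t‖ ^ 2 + ‖t - (H2Model.delayed p₂ q₂ (N + 1)).starProjection t‖ ^ 2 := by
    obtain ⟨Q, hQe⟩ := hQ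
    have hQe' := H2Model.hasExpansion_iff.1 hQe
    rw [H2Model.toH2_eq_of_eval hQe', zero_add] at hQcost
    beta_reduce at hQcost
    rw [← hQcost]
    obtain ⟨y, hy⟩ := hQcl' Q (by
      have := hQmin.1
      rwa [H2Model.toH2_eq_of_eval hQe'] at this)
    have hy' := H2Model.hasExpansion_iff.1 hy
    rw [H2Model.toH2_eq_of_eval hy', H2Model.toH2_eq_of_eval fun z hz => ?_]
    rw [hy' z hz, H2Model.Plant.closedLoop, H2Model.Plant.closedLoop, hQe' z hz]
  rw [hUcost, hclosed, H2Model.toH2_eq_of_eval ht, H2Model.toH2_eq_of_eval hv]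
  set S := H2Model.delayed p₂ q₂ (N + 1)
  set w := (H2Model.firSpace p₂ q₂ N).starProjection v with hw
  have hwv : w = v - S.starProjection v := H2Model.starProjection_firSpace (hvd 1 hV1)
  have hreal : (inner ℂ t w).im = 0 := H2Model.inner_im_eq_zero htr
    (H2Model.isReal_starProjection _ (hvr (h𝒴 hV).2))
  -- `w = v - P v` is orthogonal to the delayed space, so only the undelayed part of `T` meets it,
  -- and `⟨T - P T, w⟩ = ⟨T, w⟩`.
  have horth : inner ℂ (S.starProjection t) w = 0 := by
    rw [hwv, ← inner_conj_symm, S.starProjection_inner_eq_zero v _ (S.starProjection_apply_mem t),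
      map_zero]
  have hsplit : v + t - S.starProjection (v + t) = (t - S.starProjection t) + w := by
    rw [hwv, map_add]; abel
  have hinner : inner ℂ (t - S.starProjection t) w = ((inner ℂ t w).re : ℂ) := by
    rw [inner_sub_left, horth, sub_zero]
    exact Complex.ext rfl (by simpa using hreal)
  have hre : inner ℂ t w = ((inner ℂ t w).re : ℂ) := Complex.ext rfl (by simpa using hreal)
  rw [hsplit, @norm_add_sq ℂ, hinner, hre]
  simp only [RCLike.re_to_complex, Complex.ofReal_re]
  push_cast
  ring
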